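/- Let $K$ be a field of characteristic different from $2$. A Diophantine triple over $K$ is a set $\{a,b,c\}$ of three distinct nonzero elements of $K$ such that $ab+1$, $ac+1$ and $bc+1$ are squares in $K$ (zero counts as a square). It induces the elliptic curve $y^2=(ax+1)(bx+1)(cx+1)$ over $K$, which in Weierstrass form, after replacing $(x,y)$ by $\left(\frac{x}{abc},\frac{y}{abc}\right)$, is $$E':\quad y^2=(x+ab)(x+bc)(x+ac).$$ **Theorem 3.** (1) There exist infinitely many Diophantine triples over $\mathbb{Q}(i)$ such that the torsion subgroup of the group of $\mathbb{Q}(i)$-rational points of the induced elliptic curve is isomorphic to $\mathbb{Z}/4\mathbb{Z}\times\mathbb{Z}/4\mathbb{Z}$. (2) Let $\mathbb{Q}(i)(t)$ be the field of rational functions in one variable $t$ over $\mathbb{Q}(i)$. The elements $$a=\frac{t(t^4+2t^2+5)}{3t^4+6t^2-1},\qquad b=-\frac1a,\qquad c=\frac{16t(t^4-1)(t^2-1)}{(t^4+2t^2+5)(3t^4+6t^2-1)}$$ form a Diophantine triple over $\mathbb{Q}(i)(t)$. The group of $\mathbb{Q}(i)(t)$-rational points of the induced elliptic curve has torsion subgroup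 isomorphic to $\mathbb{Z}/4\mathbb{Z}\times\mathbb{Z}/4\mathbb{Z}$ and positive rank; the point $[0,abc]$ of $E'$ has infinite order. -/

import Mathlib

open scoped IntermediateField

/-- The quadratic field `ℚ(i)`, as a subfield of the complex numbers. -/
noncomputable abbrev QI : Type := ℚ⟮Complex.I⟯

/-- `{a, b, c}` is a Diophantine triple over the field `K`: three distinct nonzero elements such
that the product of any two of them, increased by `1`, is a square in `K` (zero is a square). -/
structure IsDiophantineTriple {K : Type*} [Field K] (a b c : K) : Prop where
  a_ne_zero : a ≠ 0
  b_ne_zero : b ≠ 0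
  c_ne_zero : c ≠ 0
  a_ne_b : a ≠ b
  a_ne_c : a ≠ c
  b_ne_c : b ≠ c
  isSquare_ab : IsSquare (a * b + 1)
  isSquare_ac : IsSquare (a * c + 1)
  isSquare_bc : IsSquare (b * c + 1)

/-- The curve induced by `{a, b, c}`, in the Weierstrass form
`y² = (x + ab)(x + bc)(x + ac)`, that is
`y² = x³ + (ab + bc + ac) x² + (a²bc + ab²c + abc²) x + a²b²c²`. -/
def inducedCurve {K : Type*} [Field K] (a b c : K) : WeierstrassCurve.Affine K where
  a₁ := 0
  a₂ := a * b + b * c + a * c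
  a₃ := 0
  a₄ := a ^ 2 * b * c + a * b ^ 2 * c + a * b * c ^ 2
  a₆ := a ^ 2 * b ^ 2 * c ^ 2

theorem inducedCurve_equation_iff {K : Type*} [Field K] (a b c x y : K) :
    (inducedCurve a b c).Equation x y ↔
      y ^ 2 = (x + a * b) * (x + b * c) * (x + a * c) := by
  rw [WeierstrassCurve.Affine.equation_iff]
  simp only [inducedCurve]
  constructor <;> intro h <;> linear_combination h

/-- The scaling `(x, y) ↦ (abc x, abc y)` identifies `y² = (ax + 1)(bx + 1)(cx + 1)` with its
Weierstrass form. -/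
theorem inducedCurve_equation_scale_iff {K : Type*} [Field K] {a b c : K}
    (ha : a ≠ 0) (hb : b ≠ 0) (hc : c ≠ 0) (x y : K) :
    (inducedCurve a b c).Equation (a * b * c * x) (a * b * c * y) ↔
      y ^ 2 = (a * x + 1) * (b * x + 1) * (c * x + 1) := by
  have h0 : (a * b * c) ^ 2 ≠ 0 := by positivity
  rw [inducedCurve_equation_iff, ← mul_right_inj' (b := y ^ 2) h0]
  constructor <;> intro h <;> linear_combination h

/-- The curve induced by a Diophantine triple is an elliptic curve. -/
theorem inducedCurve_isElliptic {K : Type*} [Field K] (h2 : (2 : K) ≠ 0) {a b c : K}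
    (h : IsDiophantineTriple a b c) : (inducedCurve a b c).IsElliptic := by
  have hΔ : (inducedCurve a b c).Δ =
      2 ^ 4 * (a * b * c) ^ 2 * ((a - b) * (a - c) * (b - c)) ^ 2 := by
    simp only [inducedCurve, WeierstrassCurve.Δ, WeierstrassCurve.b₂, WeierstrassCurve.b₄,
      WeierstrassCurve.b₆, WeierstrassCurve.b₈]
    ring
  refine ⟨isUnit_iff_ne_zero.mpr ?_⟩
  rw [hΔ]
  have ha := h.a_ne_zero
  have hb := h.b_ne_zero
  have hc := h.c_ne_zero
  have hab := sub_ne_zero.mpr h.a_ne_b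
  have hac := sub_ne_zero.mpr h.a_ne_c
  have hbc := sub_ne_zero.mpr h.b_ne_c
  simp [ha, hb, hc, hab, hac, hbc, h2]

open scoped Classical in
/-- The torsion subgroup of the group of `K`-rational points of `W` is isomorphic to
`ℤ/mℤ × ℤ/nℤ`. -/
def HasTorsion {K : Type*} [Field K] (W : WeierstrassCurve.Affine K) (m n : ℕ) : Prop :=
  Nonempty (AddCommGroup.torsion W.Point ≃+ ZMod m × ZMod n)

open scoped Classical in
/-- `(x, y)` is a (nonsingular) `K`-rational point of `W`, of infinite order. -/
def IsPointOfInfiniteOrder {K : Type*} [Field K] (W : WeierstrassCurve.Affine K) (x y : K) :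
    Prop :=
  ∃ h : W.Nonsingular x y, ¬ IsOfFinAddOrder (WeierstrassCurve.Affine.Point.some x y h)

open scoped Classical in
/-- The rank over `ℤ` of the group of `K`-rational points of `W`, that is the largest number of
independent points, is positive. -/
def HasPositiveRank {K : Type*} [Field K] (W : WeierstrassCurve.Affine K) : Prop :=
  0 < Module.rank ℤ W.Point

/-!
The torsion statements, over `ℚ(i)` and over `ℚ(i)(t)` alike, come from a single place of good reduction
with residue field `ℤ/13ℤ`. The field `ℚ(i)` embeds into `ℚ_[13]` because `-1` is a square there, and
so does `ℚ(i)(t)`, with `t` sent to a transcendental 13-adic integer congruent to `2` modulo `13`.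
At such a `t` the triple reduces to `(1, -1, 2)` and the induced curve to
`y² = (x - 1)(x - 2)(x + 2)`, a smooth curve with exactly `16` points over `ℤ/13ℤ`.

Torsion injects into the reduction (`finite_torsion_and_card_le`), so there are at most `16` torsion
points. Two facts carry this. First, the kernel of reduction is torsion-free, because the parameter
`x / y` at infinity is additive up to third order (`third_point_near_infinity`), so multiplication by
`p` shrinks a nonzero parameter without ever making it zero
(`IsShortIntegral.eq_zero_of_isOfFinAddOrder`). Second, two points with the same reduction differ by an
element of the kernel (`IsShortIntegral.sub_mem_of_norm_sub_lt`).

Conversely `ab + 1 = 0` in the family, so that the differences of the roots `-ab`, `-bc`, `-ac` of the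
cubic are `bc + 1`, `ac + 1` and `ac - bc`, all of them squares. Together with a square root of `-1` this
halves all points of order two and produces sixteen four-torsion points
(`hasTorsion_four_four_of_squares`).

Infinitely many triples over `ℚ(i)` arise from the integers `t ≡ 2` modulo `13`. Over `ℚ(i)(t)`, a
torsion point `(0, abc)` would be killed by `4`, which forces one of `b + c = a`, `a + c = b`,
`a + b = c` (`isPointOfInfiniteOrder_zero_mul`); after clearing denominators these identities fail at
`t = 0`. The place above cannot be used for this last step, since `b + c = a` does hold modulo `13`.
-/

/-! ### Chords through two points near infinity -/

theorem norm_mul_le_of_le_one {L : Type*} [NormedField L] {a b : L} {r : ℝ} (ha : ‖a‖ ≤ 1)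
    (hb : ‖b‖ ≤ r) : ‖a * b‖ ≤ r := by
  rw [norm_mul]
  exact (mul_le_of_le_one_left (norm_nonneg b) ha).trans hb

section Ultrametric

variable {L : Type*} [NormedField L] [IsUltrametricDist L]

theorem ultrametric_add_le {a b : L} {r : ℝ} (ha : ‖a‖ ≤ r) (hb : ‖b‖ ≤ r) : ‖a + b‖ ≤ r :=
  (IsUltrametricDist.norm_add_le_max a b).trans (max_le ha hb)

theorem ultrametric_sub_le {a b : L} {r : ℝ} (ha : ‖a‖ ≤ r) (hb : ‖b‖ ≤ r) : ‖a - b‖ ≤ r :=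
  sub_eq_add_neg a b ▸ ultrametric_add_le ha ((norm_neg b).trans_le hb)

theorem ultrametric_add_eq {a b : L} (h : ‖b‖ < ‖a‖) : ‖a + b‖ = ‖a‖ := by
  rw [IsUltrametricDist.norm_add_eq_max_of_norm_ne_norm h.ne', max_eq_left h.le]

theorem norm_two_le_one : ‖(2 : L)‖ ≤ 1 := by
  exact_mod_cast IsUltrametricDist.norm_natCast_le_one L 2

theorem norm_three_le_one : ‖(3 : L)‖ ≤ 1 := by
  exact_mod_cast IsUltrametricDist.norm_natCast_le_one L 3

variable {a₂ a₄ a₆ : L} (h₂ : ‖a₂‖ ≤ 1) (h₄ : ‖a₄‖ ≤ 1) (h₆ : ‖a₆‖ ≤ 1)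

include h₂ h₄ h₆

theorem norm_cubic_le_one {x : L} (hx : ‖x‖ ≤ 1) : ‖x ^ 3 + a₂ * x ^ 2 + a₄ * x + a₆‖ ≤ 1 := by
  refine ultrametric_add_le (ultrametric_add_le (ultrametric_add_le ?_ ?_) ?_) h₆
  · rw [norm_pow]; exact pow_le_one₀ (norm_nonneg _) hx
  · exact norm_mul_le_of_le_one h₂ (by rw [norm_pow]; exact pow_le_one₀ (norm_nonneg _) hx)
  · exact norm_mul_le_of_le_one h₄ hx

/-- Near infinity the term `x ^ 3` dominates the cubic. -/
theorem norm_y_sq {x y : L} (h : y ^ 2 = x ^ 3 + a₂ * x ^ 2 + a₄ * x + a₆) (hx : 1 < ‖x‖) :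
    ‖y‖ ^ 2 = ‖x‖ ^ 3 := by
  have hlow : ‖a₂ * x ^ 2 + a₄ * x + a₆‖ ≤ ‖x‖ ^ 2 := by
    refine ultrametric_add_le (ultrametric_add_le ?_ ?_) ?_
    · exact norm_mul_le_of_le_one h₂ (norm_pow _ _).le
    · exact norm_mul_le_of_le_one h₄ (by nlinarith)
    · exact h₆.trans (by nlinarith)
  have : ‖x ^ 3 + (a₂ * x ^ 2 + a₄ * x + a₆)‖ = ‖x ^ 3‖ := by
    refine ultrametric_add_eq (hlow.trans_lt ?_)
    rw [norm_pow]
    exact pow_lt_pow_right₀ hx (by norm_num)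
  rw [← norm_pow, h, ← norm_pow, ← this]
  congr 1; ring

theorem y_ne_zero_of_one_lt {x y : L} (h : y ^ 2 = x ^ 3 + a₂ * x ^ 2 + a₄ * x + a₆)
    (hx : 1 < ‖x‖) : y ≠ 0 := by
  rintro rfl
  have := norm_y_sq h₂ h₄ h₆ h hx
  have h3 : (0 : ℝ) < ‖x‖ ^ 3 := by positivity
  rw [norm_zero] at this
  linarith

theorem norm_div_sq_mul {x y : L} (h : y ^ 2 = x ^ 3 + a₂ * x ^ 2 + a₄ * x + a₆)
    (hx : 1 < ‖x‖) : ‖x / y‖ ^ 2 * ‖x‖ = 1 := by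
  have hy := norm_pos_iff.mpr (y_ne_zero_of_one_lt h₂ h₄ h₆ h hx)
  have := norm_y_sq h₂ h₄ h₆ h hx
  rw [norm_div, div_pow, this]
  field_simp

theorem norm_inv_y {x y : L} (h : y ^ 2 = x ^ 3 + a₂ * x ^ 2 + a₄ * x + a₆)
    (hx : 1 < ‖x‖) : ‖y⁻¹‖ = ‖x / y‖ ^ 3 := by
  have hy := norm_pos_iff.mpr (y_ne_zero_of_one_lt h₂ h₄ h₆ h hx)
  have := norm_y_sq h₂ h₄ h₆ h hx
  rw [norm_div, div_pow, norm_inv, ← this]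
  field_simp

theorem norm_div_lt_one {x y : L} (h : y ^ 2 = x ^ 3 + a₂ * x ^ 2 + a₄ * x + a₆)
    (hx : 1 < ‖x‖) : ‖x / y‖ < 1 := by
  have := norm_div_sq_mul h₂ h₄ h₆ h hx
  by_contra! hc
  nlinarith [one_le_pow₀ hc (n := 2)]

/-- In the coordinates `z = x / y`, `w = 1 / y` the line `y = ℓ x + m` has slope `-ℓ / m`. Factoring the
difference of the two curve equations in `(z, w)` shows that the slope of a chord through two points
near infinity is divisible by the square of the parameter. -/
theorem norm_slope_le_of_ne {x₁ y₁ x₂ y₂ ℓ m : L} {r : ℝ}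
    (e₁ : y₁ ^ 2 = x₁ ^ 3 + a₂ * x₁ ^ 2 + a₄ * x₁ + a₆)
    (e₂ : y₂ ^ 2 = x₂ ^ 3 + a₂ * x₂ ^ 2 + a₄ * x₂ + a₆)
    (hx₁ : 1 < ‖x₁‖) (hx₂ : 1 < ‖x₂‖) (hr : r < 1) (hz₁ : ‖x₁ / y₁‖ ≤ r) (hz₂ : ‖x₂ / y₂‖ ≤ r)
    (l₁ : y₁ = ℓ * x₁ + m) (l₂ : y₂ = ℓ * x₂ + m) (hne : x₁ ≠ x₂) :
    m ≠ 0 ∧ ‖ℓ‖ ≤ r ^ 2 * ‖m‖ := by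
  have hy₁ := y_ne_zero_of_one_lt h₂ h₄ h₆ e₁ hx₁
  have hy₂ := y_ne_zero_of_one_lt h₂ h₄ h₆ e₂ hx₂
  have hr0 : 0 ≤ r := (norm_nonneg _).trans hz₁
  have hw₁ : ‖y₁⁻¹‖ ≤ r := by
    rw [norm_inv_y h₂ h₄ h₆ e₁ hx₁]
    exact (pow_le_pow_left₀ (norm_nonneg _) hz₁ 3).trans (pow_le_of_le_one hr0 hr.le (by norm_num))
  have hw₂ : ‖y₂⁻¹‖ ≤ r := by
    rw [norm_inv_y h₂ h₄ h₆ e₂ hx₂]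
    exact (pow_le_pow_left₀ (norm_nonneg _) hz₂ 3).trans (pow_le_of_le_one hr0 hr.le (by norm_num))
  obtain ⟨z₁, hz₁'⟩ : ∃ z, z = x₁ / y₁ := ⟨_, rfl⟩
  obtain ⟨z₂, hz₂'⟩ : ∃ z, z = x₂ / y₂ := ⟨_, rfl⟩
  obtain ⟨w₁, hw₁'⟩ : ∃ z, z = y₁⁻¹ := ⟨_, rfl⟩
  obtain ⟨w₂, hw₂'⟩ : ∃ z, z = y₂⁻¹ := ⟨_, rfl⟩
  rw [← hz₁'] at hz₁
  rw [← hz₂'] at hz₂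
  rw [← hw₁'] at hw₁
  rw [← hw₂'] at hw₂
  have c₁ : w₁ = z₁ ^ 3 + a₂ * z₁ ^ 2 * w₁ + a₄ * z₁ * w₁ ^ 2 + a₆ * w₁ ^ 3 := by
    rw [hz₁', hw₁']; field_simp; linear_combination e₁
  have c₂ : w₂ = z₂ ^ 3 + a₂ * z₂ ^ 2 * w₂ + a₄ * z₂ * w₂ ^ 2 + a₆ * w₂ ^ 3 := by
    rw [hz₂', hw₂']; field_simp; linear_combination e₂
  have d₁ : ℓ * z₁ + m * w₁ = 1 := by
    rw [hz₁', hw₁']; field_simp; linear_combination -l₁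
  have d₂ : ℓ * z₂ + m * w₂ = 1 := by
    rw [hz₂', hw₂']; field_simp; linear_combination -l₂
  have key : (w₁ - w₂) * (1 + -(a₂ * (z₁ * z₁) + a₄ * (z₁ * (w₁ + w₂)) +
      a₆ * (w₁ * w₁ + w₁ * w₂ + w₂ * w₂))) =
      (z₁ - z₂) * (z₁ * z₁ + z₁ * z₂ + z₂ * z₂ + a₂ * (w₂ * (z₁ + z₂)) + a₄ * (w₂ * w₂)) := by
    linear_combination c₁ - c₂
  have hmul : ∀ {a b : L}, ‖a‖ ≤ r → ‖b‖ ≤ r → ‖a * b‖ ≤ r ^ 2 := by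
    intro a b ha hb
    rw [norm_mul, sq]
    exact mul_le_mul ha hb (norm_nonneg _) hr0
  have hU : ‖1 + -(a₂ * (z₁ * z₁) + a₄ * (z₁ * (w₁ + w₂)) +
      a₆ * (w₁ * w₁ + w₁ * w₂ + w₂ * w₂))‖ = 1 := by
    have : ‖-(a₂ * (z₁ * z₁) + a₄ * (z₁ * (w₁ + w₂)) +
        a₆ * (w₁ * w₁ + w₁ * w₂ + w₂ * w₂))‖ ≤ r ^ 2 := by
      rw [norm_neg]
      refine ultrametric_add_le (ultrametric_add_le ?_ ?_) ?_
      · exact norm_mul_le_of_le_one h₂ (hmul hz₁ hz₁)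
      · exact norm_mul_le_of_le_one h₄ (hmul hz₁ (ultrametric_add_le hw₁ hw₂))
      · exact norm_mul_le_of_le_one h₆ (ultrametric_add_le (ultrametric_add_le (hmul hw₁ hw₁)
          (hmul hw₁ hw₂)) (hmul hw₂ hw₂))
    rw [ultrametric_add_eq, norm_one]
    rw [norm_one]
    exact this.trans_lt (pow_lt_one₀ hr0 hr (by norm_num))
  have hV : ‖z₁ * z₁ + z₁ * z₂ + z₂ * z₂ + a₂ * (w₂ * (z₁ + z₂)) + a₄ * (w₂ * w₂)‖ ≤ r ^ 2 := by
    refine ultrametric_add_le (ultrametric_add_le (ultrametric_add_le (ultrametric_add_le ?_ ?_) ?_)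
      ?_) ?_
    · exact hmul hz₁ hz₁
    · exact hmul hz₁ hz₂
    · exact hmul hz₂ hz₂
    · exact norm_mul_le_of_le_one h₂ (hmul hw₂ (ultrametric_add_le hz₁ hz₂))
    · exact norm_mul_le_of_le_one h₄ (hmul hw₂ hw₂)
  have hw : ‖w₁ - w₂‖ ≤ ‖z₁ - z₂‖ * r ^ 2 := by
    have := congrArg norm key
    rw [norm_mul, hU, mul_one, norm_mul] at this
    rw [this]
    exact mul_le_mul_of_nonneg_left hV (norm_nonneg _)
  have hz : z₁ ≠ z₂ := by
    rintro h
    rw [h, sub_self, norm_zero, zero_mul] at hw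
    have hw' : w₁ = w₂ := sub_eq_zero.mp (norm_eq_zero.mp (le_antisymm hw (norm_nonneg _)))
    have hy : y₁ = y₂ := inv_injective (by rw [← hw₁', ← hw₂', hw'])
    apply hne
    rw [hz₁', hz₂', hy] at h
    exact (div_left_inj' hy₂).mp h
  have hz' : 0 < ‖z₁ - z₂‖ := norm_pos_iff.mpr (sub_ne_zero.mpr hz)
  have hlm : ℓ * (z₁ - z₂) = -m * (w₁ - w₂) := by linear_combination d₁ - d₂
  constructor
  · rintro rfl
    have : ℓ = 0 := by
      simpa [sub_ne_zero.mpr hz] using hlm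
    simp [this] at d₁
  · have := congrArg norm hlm
    rw [norm_mul, norm_mul, norm_neg] at this
    refine le_of_mul_le_mul_right ?_ hz'
    rw [this]
    nlinarith [norm_nonneg m]

/-- The bound of `norm_slope_le_of_ne` for the tangent at a point near infinity. -/
theorem norm_slope_le_of_tangent {x y ℓ m : L} {r : ℝ}
    (e : y ^ 2 = x ^ 3 + a₂ * x ^ 2 + a₄ * x + a₆)
    (hx : 1 < ‖x‖) (hz : ‖x / y‖ ≤ r) (l : y = ℓ * x + m) (h20 : (2 : L) ≠ 0)
    (ht : 2 * y * ℓ = 3 * x ^ 2 + 2 * a₂ * x + a₄) :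
    m ≠ 0 ∧ ‖ℓ‖ ≤ r ^ 2 * ‖m‖ := by
  have hy := y_ne_zero_of_one_lt h₂ h₄ h₆ e hx
  have h2y : 0 < ‖2 * y‖ := norm_pos_iff.mpr (mul_ne_zero h20 hy)
  have hm : 2 * y * m = -x ^ 3 + (a₄ * x + 2 * a₆) := by
    linear_combination 2 * e - 2 * y * l - x * ht
  have hm' : ‖2 * y‖ * ‖m‖ = ‖x‖ ^ 3 := by
    rw [← norm_mul, hm, ultrametric_add_eq, norm_neg, norm_pow]
    have : ‖a₄ * x + 2 * a₆‖ ≤ ‖x‖ :=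
      ultrametric_add_le (norm_mul_le_of_le_one h₄ le_rfl)
        (norm_mul_le_of_le_one norm_two_le_one (h₆.trans hx.le))
    rw [norm_neg, norm_pow]
    exact this.trans_lt (lt_self_pow₀ hx (by norm_num))
  have hl : ‖2 * y‖ * ‖ℓ‖ ≤ ‖x‖ ^ 2 := by
    rw [← norm_mul, ht]
    refine ultrametric_add_le (ultrametric_add_le ?_ ?_) ?_
    · exact norm_mul_le_of_le_one norm_three_le_one (norm_pow _ _).le
    · rw [mul_assoc]
      exact norm_mul_le_of_le_one norm_two_le_one (norm_mul_le_of_le_one h₂ (by nlinarith))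
    · exact h₄.trans (by nlinarith)
  have hxpos : 0 < ‖x‖ := by linarith
  have hzx := norm_div_sq_mul h₂ h₄ h₆ e hx
  constructor
  · rintro rfl
    rw [norm_zero, mul_zero] at hm'
    have : 0 < ‖x‖ ^ 3 := by positivity
    linarith
  · have h1 : ‖ℓ‖ ≤ ‖x / y‖ ^ 2 * ‖m‖ := by
      refine le_of_mul_le_mul_left ?_ h2y
      calc ‖2 * y‖ * ‖ℓ‖ ≤ ‖x‖ ^ 2 := hl
        _ = (‖x / y‖ ^ 2 * ‖x‖) * ‖x‖ ^ 2 := by rw [hzx, one_mul]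
        _ = ‖x / y‖ ^ 2 * ‖x‖ ^ 3 := by ring
        _ = ‖2 * y‖ * (‖x / y‖ ^ 2 * ‖m‖) := by rw [← hm']; ring
    refine h1.trans (mul_le_mul_of_nonneg_right ?_ (norm_nonneg _))
    exact pow_le_pow_left₀ (norm_nonneg _) hz 2

/-- If a line meets the curve in two points near infinity, then the third intersection point is near
infinity as well, and the parameters `x / y` of the three points add up to zero up to third order.
The hypotheses `s₁`, `s₂`, `s₃` say that `x₁`, `x₂`, `x₃` are the roots of the cubic obtained by
substituting the line into the equation of the curve. -/
theorem third_point_near_infinity {x₁ y₁ x₂ y₂ x₃ y₃ ℓ m : L} {r : ℝ}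
    (e₁ : y₁ ^ 2 = x₁ ^ 3 + a₂ * x₁ ^ 2 + a₄ * x₁ + a₆)
    (e₂ : y₂ ^ 2 = x₂ ^ 3 + a₂ * x₂ ^ 2 + a₄ * x₂ + a₆)
    (e₃ : y₃ ^ 2 = x₃ ^ 3 + a₂ * x₃ ^ 2 + a₄ * x₃ + a₆)
    (hx₁ : 1 < ‖x₁‖) (hx₂ : 1 < ‖x₂‖) (hr : r < 1) (hz₁ : ‖x₁ / y₁‖ ≤ r) (hz₂ : ‖x₂ / y₂‖ ≤ r)
    (l₁ : y₁ = ℓ * x₁ + m) (l₂ : y₂ = ℓ * x₂ + m) (l₃ : y₃ = ℓ * x₃ + m)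
    (s₁ : x₁ + x₂ + x₃ = ℓ ^ 2 - a₂) (s₂ : x₁ * x₂ + x₁ * x₃ + x₂ * x₃ = a₄ - 2 * ℓ * m)
    (s₃ : x₁ * x₂ * x₃ = m ^ 2 - a₆) (hm : m ≠ 0) (hℓ : ‖ℓ‖ ≤ r ^ 2 * ‖m‖) :
    1 < ‖x₃‖ ∧ ‖x₁ / y₁ + x₂ / y₂ + x₃ / y₃‖ ≤ r ^ 3 := by
  have hr0 : 0 ≤ r := (norm_nonneg _).trans hz₁
  have hy₁ := y_ne_zero_of_one_lt h₂ h₄ h₆ e₁ hx₁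
  have hy₂ := y_ne_zero_of_one_lt h₂ h₄ h₆ e₂ hx₂
  have hmpos : 0 < ‖m‖ := norm_pos_iff.mpr hm
  have hr3 : r ^ 3 < 1 := pow_lt_one₀ hr0 hr (by norm_num)
  have hr2 : r ^ 2 < 1 := pow_lt_one₀ hr0 hr (by norm_num)
  obtain ⟨α, hα⟩ : ∃ α, α = -ℓ / m := ⟨_, rfl⟩
  have hα' : ‖α‖ ≤ r ^ 2 := by
    rw [hα, norm_div, norm_neg, div_le_iff₀ hmpos]; exact hℓ
  have hα1 : ‖α‖ ≤ 1 := hα'.trans hr2.le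
  have hℓα : ℓ = -α * m := by rw [hα]; field_simp
  -- the line in the coordinates `z = x / y`, `w = 1 / y` is `w = α z + 1 / m`
  have hβ : ‖m⁻¹‖ ≤ r ^ 3 := by
    have : m⁻¹ = y₁⁻¹ - α * (x₁ / y₁) := by
      rw [hα]; field_simp; linear_combination l₁
    rw [this]
    refine ultrametric_sub_le ?_ ?_
    · rw [norm_inv_y h₂ h₄ h₆ e₁ hx₁]
      exact pow_le_pow_left₀ (norm_nonneg _) hz₁ 3
    · rw [norm_mul, pow_succ]
      exact mul_le_mul hα' hz₁ (norm_nonneg _) (by positivity)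
  have hD : ‖1 + (a₂ * α + a₄ * (α * α) + a₆ * (α * (α * α)))‖ = 1 := by
    have : ‖a₂ * α + a₄ * (α * α) + a₆ * (α * (α * α))‖ ≤ r ^ 2 := by
      have h1 := norm_mul_le_of_le_one hα1 hα'
      exact ultrametric_add_le (ultrametric_add_le (norm_mul_le_of_le_one h₂ hα')
        (norm_mul_le_of_le_one h₄ h1))
        (norm_mul_le_of_le_one h₆ (norm_mul_le_of_le_one hα1 h1))
    rw [ultrametric_add_eq, norm_one]
    rw [norm_one]
    exact this.trans_lt hr2
  obtain ⟨D, hDdef⟩ : ∃ D, D = 1 + (a₂ * α + a₄ * (α * α) + a₆ * (α * (α * α))) := ⟨_, rfl⟩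
  rw [← hDdef] at hD
  have hD0 : D ≠ 0 := by rintro rfl; simp at hD
  -- up to `m ^ 3`, the product of the `y`-coordinates is the leading coefficient, a unit, of the cubic
  -- in `z` obtained by substituting the line into the curve
  have hprod : y₁ * y₂ * y₃ = m ^ 3 * D := by
    rw [l₁, l₂, l₃, hDdef, hℓα]
    rw [hℓα] at s₁ s₂
    linear_combination (-α * m) ^ 3 * s₃ + (-α * m) ^ 2 * m * s₂ + (-α * m) * m ^ 2 * s₁
  have hy₃ : y₃ ≠ 0 := by
    rintro rfl
    rw [mul_zero] at hprod
    exact mul_ne_zero (pow_ne_zero 3 hm) hD0 hprod.symm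
  have hsum : x₁ / y₁ + x₂ / y₂ + x₃ / y₃ =
      -(m⁻¹ * (a₂ + 2 * a₄ * α + 3 * a₆ * (α * α))) / D := by
    have h1 : x₁ / y₁ + x₂ / y₂ + x₃ / y₃ =
        (x₁ * y₂ * y₃ + x₂ * y₁ * y₃ + x₃ * y₁ * y₂) / (y₁ * y₂ * y₃) := by
      field_simp
    have h2 : x₁ * y₂ * y₃ + x₂ * y₁ * y₃ + x₃ * y₁ * y₂ =
        -m ^ 2 * (a₂ + 2 * a₄ * α + 3 * a₆ * (α * α)) := by
      rw [l₁, l₂, l₃, hℓα]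
      rw [hℓα] at s₁ s₂
      linear_combination 3 * (-α * m) ^ 2 * s₃ + 2 * (-α * m) * m * s₂ + m ^ 2 * s₁
    rw [h1, h2, hprod]
    field_simp
  have hS : ‖x₁ / y₁ + x₂ / y₂ + x₃ / y₃‖ ≤ r ^ 3 := by
    rw [hsum, norm_div, hD, div_one, norm_neg, mul_comm]
    refine norm_mul_le_of_le_one ?_ hβ
    refine ultrametric_add_le (ultrametric_add_le h₂ ?_) ?_
    · rw [mul_assoc]
      exact norm_mul_le_of_le_one norm_two_le_one (norm_mul_le_of_le_one h₄ hα1)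
    · rw [mul_assoc]
      exact norm_mul_le_of_le_one norm_three_le_one (norm_mul_le_of_le_one h₆
        (norm_mul_le_of_le_one hα1 hα1))
  refine ⟨?_, hS⟩
  have hz₃ : ‖x₃ / y₃‖ ≤ r := by
    have : x₃ / y₃ = (x₁ / y₁ + x₂ / y₂ + x₃ / y₃) - (x₁ / y₁ + x₂ / y₂) := by ring
    rw [this]
    exact ultrametric_sub_le (hS.trans (pow_le_of_le_one hr0 hr.le (by norm_num)))
      (ultrametric_add_le hz₁ hz₂)
  by_contra! hc
  have hy : ‖y₃‖ ≤ 1 := by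
    have := norm_cubic_le_one h₂ h₄ h₆ hc
    rw [← e₃, norm_pow] at this
    exact (pow_le_one_iff_of_nonneg (norm_nonneg _) (by norm_num)).mp this
  have hw : ‖y₃⁻¹‖ < 1 := by
    have : y₃⁻¹ = α * (x₃ / y₃) + m⁻¹ := by
      rw [hα]; field_simp; linear_combination -l₃
    rw [this]
    refine (ultrametric_add_le (norm_mul_le_of_le_one hα1 hz₃)
      (hβ.trans (pow_le_of_le_one hr0 hr.le (by norm_num)))).trans_lt hr
  rw [norm_inv] at hw
  exact absurd hw (not_lt.mpr (one_le_inv_iff₀.mpr ⟨norm_pos_iff.mpr hy₃, hy⟩))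

end Ultrametric

/-! ### The kernel of reduction -/

section Points

open WeierstrassCurve.Affine

variable {K : Type*} [Field K] {W : WeierstrassCurve.Affine K}

theorem equation_iff_of_short (h₁ : W.a₁ = 0) (h₃ : W.a₃ = 0) {x y : K} :
    W.Equation x y ↔ y ^ 2 = x ^ 3 + W.a₂ * x ^ 2 + W.a₄ * x + W.a₆ := by
  rw [equation_iff, h₁, h₃]
  simp

theorem negY_of_short (h₁ : W.a₁ = 0) (h₃ : W.a₃ = 0) (x y : K) : W.negY x y = -y := by
  simp [negY, h₁, h₃]

/-- Addition of two points that are not opposite, described by the line `y = ℓ x + m` through them and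
the elementary symmetric functions of the three `x`-coordinates. Chords and tangents are treated
together; the last clause records the slope in the tangent case, where `2 ≠ 0` is forced. -/
theorem exists_chord [DecidableEq K] (h₁ : W.a₁ = 0) (h₃ : W.a₃ = 0) {x₁ y₁ x₂ y₂ : K}
    (n₁ : W.Nonsingular x₁ y₁) (n₂ : W.Nonsingular x₂ y₂) (hxy : ¬(x₁ = x₂ ∧ y₁ = -y₂)) :
    ∃ ℓ m x₃ : K, ∃ n₃ : W.Nonsingular x₃ (-(ℓ * x₃ + m)),
      Point.some x₁ y₁ n₁ + Point.some x₂ y₂ n₂ = Point.some x₃ (-(ℓ * x₃ + m)) n₃ ∧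
      y₁ = ℓ * x₁ + m ∧ y₂ = ℓ * x₂ + m ∧ x₁ + x₂ + x₃ = ℓ ^ 2 - W.a₂ ∧
      x₁ * x₂ + x₁ * x₃ + x₂ * x₃ = W.a₄ - 2 * ℓ * m ∧ x₁ * x₂ * x₃ = m ^ 2 - W.a₆ ∧
      (x₁ = x₂ → (2 : K) ≠ 0 ∧ 2 * y₁ * ℓ = 3 * x₁ ^ 2 + 2 * W.a₂ * x₁ + W.a₄) := by
  have hxy' : ¬(x₁ = x₂ ∧ y₁ = W.negY x₂ y₂) := by rwa [negY_of_short h₁ h₃]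
  have e₁ := (equation_iff_of_short h₁ h₃).mp n₁.1
  have e₂ := (equation_iff_of_short h₁ h₃).mp n₂.1
  obtain ⟨ℓ, hℓ⟩ : ∃ ℓ, ℓ = W.slope x₁ x₂ y₁ y₂ := ⟨_, rfl⟩
  have hX : W.addX x₁ x₂ ℓ = ℓ ^ 2 - W.a₂ - x₁ - x₂ := by simp [addX, h₁]
  have hY : W.addY x₁ x₂ y₁ ℓ = -(ℓ * (ℓ ^ 2 - W.a₂ - x₁ - x₂) + (y₁ - ℓ * x₁)) := by
    rw [addY, negY_of_short h₁ h₃, negAddY, hX]; ring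
  have n₃ := nonsingular_add n₁ n₂ hxy'
  have hadd := Point.add_some hxy' (h₁ := n₁) (h₂ := n₂)
  simp only [← hℓ, hX, hY] at n₃ hadd
  have hy₂ : y₂ = ℓ * x₂ + (y₁ - ℓ * x₁) ∧
      (x₁ = x₂ → (2 : K) ≠ 0 ∧ 2 * y₁ * ℓ = 3 * x₁ ^ 2 + 2 * W.a₂ * x₁ + W.a₄) ∧
      2 * y₁ * ℓ = x₁ ^ 2 + x₁ * x₂ + x₂ ^ 2 + W.a₂ * (x₁ + x₂) + W.a₄ + ℓ ^ 2 * (x₁ - x₂) := by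
    by_cases hx : x₁ = x₂
    · have hy : y₁ ≠ -y₂ := fun h => hxy ⟨hx, h⟩
      have hyy := Y_eq_of_Y_ne n₁.1 n₂.1 hx (by rwa [negY_of_short h₁ h₃])
      subst hx
      subst hyy
      have h2y : y₁ + y₁ ≠ 0 := fun h => hy (eq_neg_of_add_eq_zero_left h)
      rw [slope_of_Y_ne rfl (by rwa [negY_of_short h₁ h₃]), negY_of_short h₁ h₃, h₁,
        sub_neg_eq_add, eq_div_iff h2y] at hℓ
      refine ⟨by ring, fun _ => ⟨fun h => h2y ?_, by linear_combination hℓ⟩,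
        by linear_combination hℓ⟩
      linear_combination y₁ * h
    · have hx' := sub_ne_zero.mpr hx
      rw [slope_of_X_ne hx, eq_div_iff hx'] at hℓ
      refine ⟨by linear_combination hℓ, fun h => absurd h hx, ?_⟩
      refine mul_left_cancel₀ hx' ?_
      linear_combination (y₁ + y₂ - ℓ * (x₁ - x₂)) * hℓ + e₁ - e₂
  refine ⟨ℓ, y₁ - ℓ * x₁, ℓ ^ 2 - W.a₂ - x₁ - x₂, n₃, hadd, by ring, hy₂.1, by ring, ?_, ?_,
    hy₂.2.1⟩
  · linear_combination hy₂.2.2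
  · linear_combination x₁ * hy₂.2.2 - e₁

/-- The local parameter `x / y` at infinity, extended by `0` at the point at infinity itself. -/
def WeierstrassCurve.Affine.Point.param : W.Point → K
  | .zero => 0
  | .some x y _ => x / y

variable {L : Type*} [NormedField L] (φ : K →+* L)

/-- The points that reduce to the point at infinity, for the absolute value on `K` induced by the
embedding `φ` into an ultrametric field: those whose `x`-coordinate is not integral. -/
def WeierstrassCurve.Affine.Point.InReductionKernel : W.Point → Prop
  | .zero => True
  | .some x _ _ => 1 < ‖φ x‖

open WeierstrassCurve.Affine.Point

/-- The curve is `y² = x³ + a₂ x² + a₄ x + a₆` with coefficients that are integral for the absolute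
value induced by `φ`. -/
structure IsShortIntegral (φ : K →+* L) (W : WeierstrassCurve.Affine K) : Prop where
  a₁ : W.a₁ = 0
  a₃ : W.a₃ = 0
  a₂ : ‖φ W.a₂‖ ≤ 1
  a₄ : ‖φ W.a₄‖ ≤ 1
  a₆ : ‖φ W.a₆‖ ≤ 1

variable {φ}

theorem IsShortIntegral.equation (H : IsShortIntegral φ W) {x y : K} (h : W.Equation x y) :
    φ y ^ 2 = φ x ^ 3 + φ W.a₂ * φ x ^ 2 + φ W.a₄ * φ x + φ W.a₆ := by
  simpa using congrArg φ ((equation_iff_of_short H.a₁ H.a₃).mp h)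

variable [IsUltrametricDist L]

theorem IsShortIntegral.norm_param_lt_one (H : IsShortIntegral φ W) {P : W.Point}
    (hP : P.InReductionKernel φ) : ‖φ P.param‖ < 1 := by
  rcases P with _ | ⟨x, y, h⟩
  · simp [Point.param]
  · simp only [Point.param, map_div₀]
    exact norm_div_lt_one H.a₂ H.a₄ H.a₆ (H.equation h.1) hP

theorem IsShortIntegral.param_ne_zero (H : IsShortIntegral φ W) {P : W.Point}
    (hP : P.InReductionKernel φ) (h0 : P ≠ 0) : P.param ≠ 0 := by
  rcases P with _ | ⟨x, y, h⟩
  · exact absurd rfl h0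
  · have hx : 1 < ‖φ x‖ := hP
    refine div_ne_zero ?_ ?_
    · rintro rfl
      simp at hx
      linarith
    · rintro rfl
      exact y_ne_zero_of_one_lt H.a₂ H.a₄ H.a₆ (H.equation h.1) hP (map_zero φ)

/-- The kernel of reduction is closed under addition, and the parameter `x / y` is additive on it up to
third order. -/
theorem IsShortIntegral.add_mem [DecidableEq K] (H : IsShortIntegral φ W) {P Q : W.Point}
    (hP : P.InReductionKernel φ) (hQ : Q.InReductionKernel φ) {r : ℝ} (hr : r < 1)
    (hPr : ‖φ P.param‖ ≤ r) (hQr : ‖φ Q.param‖ ≤ r) :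
    (P + Q).InReductionKernel φ ∧ ‖φ ((P + Q).param - (P.param + Q.param))‖ ≤ r ^ 3 := by
  have hr0 : 0 ≤ r := (norm_nonneg _).trans hPr
  have hr3 : 0 ≤ r ^ 3 := by positivity
  rcases P with _ | ⟨x₁, y₁, n₁⟩
  · rw [← zero_def, zero_add]
    exact ⟨hQ, by simpa [zero_def, Point.param] using hr3⟩
  rcases Q with _ | ⟨x₂, y₂, n₂⟩
  · rw [← zero_def, add_zero]
    exact ⟨hP, by simpa [zero_def, Point.param] using hr3⟩
  by_cases hxy : x₁ = x₂ ∧ y₁ = -y₂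
  · obtain ⟨rfl, rfl⟩ := hxy
    rw [add_of_Y_eq rfl (negY_of_short H.a₁ H.a₃ _ _).symm]
    exact ⟨trivial, by simpa [zero_def, Point.param, div_neg] using hr3⟩
  · obtain ⟨ℓ, m, x₃, n₃, hadd, l₁, l₂, s₁, s₂, s₃, ht⟩ := exists_chord H.a₁ H.a₃ n₁ n₂ hxy
    rw [hadd]
    simp only [Point.param, map_div₀] at hPr hQr
    have E₁ := H.equation n₁.1
    have E₂ := H.equation n₂.1
    have L₁ := congrArg φ l₁
    have L₂ := congrArg φ l₂
    rw [map_add, map_mul] at L₁ L₂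
    have key : φ m ≠ 0 ∧ ‖φ ℓ‖ ≤ r ^ 2 * ‖φ m‖ := by
      by_cases hx : x₁ = x₂
      · obtain ⟨h20, ht⟩ := ht hx
        have ht' := congrArg φ ht
        simp only [map_add, map_mul, map_pow, map_ofNat] at ht'
        refine norm_slope_le_of_tangent H.a₂ H.a₄ H.a₆ E₁ hP hPr L₁ ?_ ht'
        rw [← map_ofNat φ 2]
        exact (map_ne_zero φ).mpr h20
      · exact norm_slope_le_of_ne H.a₂ H.a₄ H.a₆ E₁ E₂ hP hQ hr hPr hQr L₁ L₂
          (fun h => hx (φ.injective h))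
    have E₃ := H.equation n₃.1
    have S₁ := congrArg φ s₁
    have S₂ := congrArg φ s₂
    have S₃ := congrArg φ s₃
    simp only [map_add, map_mul, map_sub, map_pow, map_neg, map_ofNat, neg_sq] at S₁ S₂ S₃ E₃
    obtain ⟨h1, h2⟩ := third_point_near_infinity H.a₂ H.a₄ H.a₆ E₁ E₂ E₃ hP hQ hr hPr hQr L₁ L₂
      rfl S₁ S₂ S₃ key.1 key.2
    refine ⟨h1, ?_⟩
    rw [← norm_neg]
    refine (congrArg norm ?_).trans_le h2
    simp only [Point.param, map_sub, map_add, map_div₀, map_mul, map_neg, div_neg]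
    ring

theorem IsShortIntegral.nsmul_mem [DecidableEq K] (H : IsShortIntegral φ W) {P : W.Point}
    (hP : P.InReductionKernel φ) (n : ℕ) :
    (n • P).InReductionKernel φ ∧ ‖φ ((n • P).param - n * P.param)‖ ≤ ‖φ P.param‖ ^ 3 := by
  have hr := H.norm_param_lt_one hP
  induction n with
  | zero => exact ⟨by simp [zero_def, Point.InReductionKernel], by
      simp [zero_def, Point.param]⟩
  | succ n ih =>
    have hn : ‖φ ((n • P).param)‖ ≤ ‖φ P.param‖ := by
      have : φ ((n • P).param) = φ ((n • P).param - n * P.param) + n * φ P.param := by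
        simp
      rw [this]
      exact ultrametric_add_le (ih.2.trans (pow_le_of_le_one (norm_nonneg _) hr.le (by norm_num)))
        (norm_mul_le_of_le_one (IsUltrametricDist.norm_natCast_le_one L n) le_rfl)
    obtain ⟨h1, h2⟩ := H.add_mem ih.1 hP hr hn le_rfl
    rw [succ_nsmul]
    refine ⟨h1, ?_⟩
    have : (n • P + P).param - ((n + 1 : ℕ) : K) * P.param =
        ((n • P + P).param - ((n • P).param + P.param)) + ((n • P).param - n * P.param) := by
      push_cast; ring
    rw [this, map_add]
    exact ultrametric_add_le h2 ih.2

section Padic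

variable {p : ℕ} [Fact p.Prime] {φ : K →+* ℚ_[p]}

/-- Multiplication by `p` moves a nonzero point of the kernel of reduction strictly closer to infinity.
Since `‖x / y‖ ≤ 1 / p`, the third-order error is smaller than `p * (x / y)`. -/
theorem IsShortIntegral.prime_nsmul [DecidableEq K] (H : IsShortIntegral φ W) {P : W.Point}
    (hP : P.InReductionKernel φ) (h0 : P ≠ 0) :
    (p • P).InReductionKernel φ ∧ p • P ≠ 0 ∧ ‖φ (p • P).param‖ < ‖φ P.param‖ := by
  obtain ⟨h1, h2⟩ := H.nsmul_mem hP p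
  have hpos : 0 < ‖φ P.param‖ := norm_pos_iff.mpr ((map_ne_zero φ).mpr (H.param_ne_zero hP h0))
  have hp1 : (1 : ℝ) < p := by exact_mod_cast (Fact.out : p.Prime).one_lt
  have hle : ‖φ P.param‖ ≤ (p : ℝ)⁻¹ := by
    have := (Padic.norm_le_pow_iff_norm_lt_pow_add_one (φ P.param) (-1)).mpr
      (by simpa using H.norm_param_lt_one hP)
    simpa using this
  have hpz : ‖(p : ℚ_[p]) * φ P.param‖ = (p : ℝ)⁻¹ * ‖φ P.param‖ := by
    rw [norm_mul, Padic.norm_p]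
  have hlt : ‖φ ((p • P).param - p * P.param)‖ < ‖(p : ℚ_[p]) * φ P.param‖ := by
    refine h2.trans_lt ?_
    rw [hpz, pow_succ]
    refine mul_lt_mul_of_pos_right ?_ hpos
    calc ‖φ P.param‖ ^ 2 ≤ (p : ℝ)⁻¹ ^ 2 := pow_le_pow_left₀ hpos.le hle 2
      _ < (p : ℝ)⁻¹ := pow_lt_self_of_lt_one₀ (by positivity) (inv_lt_one_of_one_lt₀ hp1)
        (by norm_num)
  have heq : ‖φ (p • P).param‖ = (p : ℝ)⁻¹ * ‖φ P.param‖ := by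
    rw [← hpz, ← ultrametric_add_eq hlt]
    congr 1
    simp
  refine ⟨h1, ?_, ?_⟩
  · intro h
    rw [h] at heq
    have : 0 < (p : ℝ)⁻¹ * ‖φ P.param‖ := by positivity
    simp [Point.param] at heq
    rcases heq with h | h
    · exact (Fact.out : p.Prime).ne_zero h
    · exact H.param_ne_zero hP h0 h
  · rw [heq]
    exact mul_lt_of_lt_one_left hpos (inv_lt_one_of_one_lt₀ hp1)

/-- The kernel of reduction is torsion-free: the points `p ^ k • P` are pairwise distinct. -/
theorem IsShortIntegral.eq_zero_of_isOfFinAddOrder [DecidableEq K] (H : IsShortIntegral φ W)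
    {P : W.Point} (hP : P.InReductionKernel φ) (hfin : IsOfFinAddOrder P) : P = 0 := by
  by_contra h0
  let f : ℕ → W.Point := fun k => (p ^ k) • P
  have hf : ∀ k, (f k).InReductionKernel φ ∧ f k ≠ 0 := by
    intro k
    induction k with
    | zero => simpa [f] using ⟨hP, h0⟩
    | succ k ih =>
      have := H.prime_nsmul ih.1 ih.2
      simp only [f, pow_succ, mul_nsmul] at this ⊢
      exact ⟨this.1, this.2.1⟩
  have hanti : StrictAnti fun k => ‖φ (f k).param‖ := by
    refine strictAnti_nat_of_succ_lt fun k => ?_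
    have := (H.prime_nsmul (hf k).1 (hf k).2).2.2
    simp only [f, pow_succ, mul_nsmul] at this ⊢
    exact this
  have hinj : Function.Injective f := fun a b hab => hanti.injective (by simp only [hab])
  have hmem : ∀ k, f k ∈ (AddSubmonoid.multiples P : Set W.Point) := fun k => ⟨p ^ k, rfl⟩
  exact Set.infinite_of_injective_forall_mem hinj hmem (finite_multiples.mpr hfin)

end Padic

end Points

/-! ### Torsion and reduction modulo `p` -/

section Reduction

open WeierstrassCurve.Affine WeierstrassCurve.Affine.Point

variable {K : Type*} [Field K] [DecidableEq K] {W : WeierstrassCurve.Affine K}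

/-- Two integral points with the same reduction differ by an element of the kernel of reduction. The
hypothesis `hgood` says that the reduced cubic has no multiple root; with it, the line through the
first point and the negative of the second has a slope that is not integral. -/
theorem IsShortIntegral.sub_mem_of_norm_sub_lt {L : Type*} [NormedField L] [IsUltrametricDist L]
    {φ : K →+* L} (H : IsShortIntegral φ W) (h2 : ‖(2 : L)‖ = 1)
    (hgood : ∀ x : L, ‖x‖ ≤ 1 → ‖x ^ 3 + φ W.a₂ * x ^ 2 + φ W.a₄ * x + φ W.a₆‖ < 1 →
      ‖3 * x ^ 2 + 2 * φ W.a₂ * x + φ W.a₄‖ = 1)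
    {x₁ y₁ x₂ y₂ : K} (n₁ : W.Nonsingular x₁ y₁) (n₂ : W.Nonsingular x₂ y₂)
    (hx₁ : ‖φ x₁‖ ≤ 1) (hx₂ : ‖φ x₂‖ ≤ 1) (hx : ‖φ x₁ - φ x₂‖ < 1) (hy : ‖φ y₁ - φ y₂‖ < 1) :
    (Point.some x₁ y₁ n₁ - Point.some x₂ y₂ n₂).InReductionKernel φ := by
  by_cases hxy : x₁ = x₂ ∧ y₁ = y₂
  · obtain ⟨rfl, rfl⟩ := hxy
    rw [sub_self]
    trivial
  have n₂' : W.Nonsingular x₂ (-y₂) := by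
    rw [← negY_of_short H.a₁ H.a₃ x₂ y₂]
    exact (nonsingular_neg _ _).mpr n₂
  have hneg : -Point.some x₂ y₂ n₂ = Point.some x₂ (-y₂) n₂' := by
    rw [neg_some, Point.some.injEq]
    exact ⟨rfl, negY_of_short H.a₁ H.a₃ x₂ y₂⟩
  obtain ⟨ℓ, m, x₃, n₃, hadd, l₁, l₂, s₁, -, -, ht⟩ :=
    exists_chord H.a₁ H.a₃ n₁ n₂' (by rwa [neg_neg])
  rw [sub_eq_add_neg, hneg, hadd]
  have E₁ := H.equation n₁.1
  have E₂ := H.equation n₂.1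
  have hgood₁ := hgood (φ x₁) hx₁
  rw [← E₁, norm_pow] at hgood₁
  -- the slope is not integral
  have hℓ : 1 < ‖φ ℓ‖ := by
    suffices ∃ ε : L, ‖ε‖ < 1 ∧ 1 = ‖ε‖ * ‖φ ℓ‖ by
      obtain ⟨ε, hε, hεℓ⟩ := this
      by_contra! hc
      have := mul_le_of_le_one_right (norm_nonneg ε) hc
      linarith
    by_cases hxe : x₁ = x₂
    · obtain ⟨-, ht⟩ := ht hxe
      have hyy : y₂ = -y₁ := by rw [l₁, hxe]; linear_combination -l₂
      have ht' := congrArg φ ht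
      simp only [map_add, map_mul, map_pow, map_ofNat] at ht'
      have h2y : ‖2 * φ y₁‖ < 1 := by
        rw [hyy, map_neg] at hy
        convert hy using 2
        ring
      refine ⟨2 * φ y₁, h2y, ?_⟩
      rw [← norm_mul, ht', hgood₁]
      rw [norm_mul, h2, one_mul] at h2y
      exact pow_lt_one₀ (norm_nonneg _) h2y two_ne_zero
    · by_cases hy₁ : ‖φ y₁‖ < 1
      · refine ⟨φ y₁ - φ y₂, hy, ?_⟩
        have hq : (φ y₁ - φ y₂) * φ ℓ = 3 * φ x₁ ^ 2 + 2 * φ W.a₂ * φ x₁ + φ W.a₄ +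
            (φ x₂ + 2 * φ x₁ + φ W.a₂) * (φ x₂ - φ x₁) := by
          have hxe' : φ x₁ - φ x₂ ≠ 0 := sub_ne_zero.mpr fun h => hxe (φ.injective h)
          have l₁' := congrArg φ l₁
          have l₂' := congrArg φ l₂
          simp only [map_add, map_mul, map_neg] at l₁' l₂'
          refine mul_left_cancel₀ hxe' ?_
          linear_combination E₁ - E₂ - (φ y₁ - φ y₂) * (l₁' - l₂')
        have hg := hgood₁ (pow_lt_one₀ (norm_nonneg _) hy₁ two_ne_zero)
        rw [← norm_mul, hq, ultrametric_add_eq, hg]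
        rw [hg]
        refine (norm_mul_le_of_le_one ?_ le_rfl).trans_lt (by rwa [norm_sub_rev])
        exact ultrametric_add_le (ultrametric_add_le hx₂
          (norm_mul_le_of_le_one norm_two_le_one hx₁)) H.a₂
      · refine ⟨φ x₁ - φ x₂, hx, ?_⟩
        have hyle : ‖φ y₁‖ ≤ 1 := by
          have := norm_cubic_le_one H.a₂ H.a₄ H.a₆ hx₁
          rw [← E₁, norm_pow] at this
          exact (pow_le_one_iff_of_nonneg (norm_nonneg _) two_ne_zero).mp this
        have hy1 : ‖φ y₁‖ = 1 := le_antisymm hyle (not_lt.mp hy₁)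
        have hs : (φ x₁ - φ x₂) * φ ℓ = 2 * φ y₁ + -(φ y₁ - φ y₂) := by
          have l₁' := congrArg φ l₁
          have l₂' := congrArg φ l₂
          simp only [map_add, map_mul, map_neg] at l₁' l₂'
          linear_combination l₂' - l₁'
        rw [← norm_mul, hs, ultrametric_add_eq, norm_mul, h2, hy1, one_mul]
        rw [norm_neg, norm_mul, h2, hy1, one_mul]
        exact hy
  have hx₃ : φ x₃ = φ ℓ ^ 2 + -(φ W.a₂ + φ x₁ + φ x₂) := by
    have := congrArg φ s₁
    simp only [map_add, map_sub, map_pow] at this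
    linear_combination this
  change 1 < ‖φ x₃‖
  have hℓ2 : 1 < ‖φ ℓ ^ 2‖ := by
    rw [norm_pow]
    exact one_lt_pow₀ hℓ two_ne_zero
  rw [hx₃, ultrametric_add_eq]
  · exact hℓ2
  · rw [norm_neg]
    exact (ultrametric_add_le (ultrametric_add_le H.a₂ hx₁) hx₂).trans_lt hℓ2

theorem PadicInt.toZMod_eq_zero_iff {p : ℕ} [Fact p.Prime] (x : ℤ_[p]) :
    PadicInt.toZMod x = 0 ↔ ‖x‖ < 1 := by
  rw [← RingHom.mem_ker, PadicInt.ker_toZMod, PadicInt.maximalIdeal_eq_span_p,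
    Ideal.mem_span_singleton, PadicInt.norm_lt_one_iff_dvd]

/-- The residue class in `ℤ/pℤ` of a `p`-adic number `u` with `‖u‖ ≤ 1`. -/
noncomputable def Padic.residue {p : ℕ} [Fact p.Prime] (u : ℚ_[p]) (hu : ‖u‖ ≤ 1) : ZMod p :=
  PadicInt.toZMod (show ℤ_[p] from ⟨u, hu⟩)

theorem Padic.exists_coe_eq_and_toZMod_eq {p : ℕ} [Fact p.Prime] (u : ℚ_[p]) (hu : ‖u‖ ≤ 1) :
    ∃ U : ℤ_[p], (U : ℚ_[p]) = u ∧ PadicInt.toZMod U = Padic.residue u hu :=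
  ⟨⟨u, hu⟩, rfl, rfl⟩

variable {p : ℕ} [Fact p.Prime] {φ : K →+* ℚ_[p]}

/-- If the reduction modulo an odd prime `p` is good, the torsion subgroup injects into the set of points
of the reduced curve over `ℤ/pℤ`: torsion points with the same reduction differ by a torsion element
of the kernel of reduction. Only injectivity of the reduction map is needed, not its additivity. -/
theorem finite_torsion_and_card_le (h₁ : W.a₁ = 0) (h₃ : W.a₃ = 0) {A₂ A₄ A₆ : ℤ_[p]}
    (h₂ : φ W.a₂ = A₂) (h₄ : φ W.a₄ = A₄) (h₆ : φ W.a₆ = A₆) (hp : p ≠ 2) {α₂ α₄ α₆ : ZMod p}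
    (hα₂ : PadicInt.toZMod A₂ = α₂) (hα₄ : PadicInt.toZMod A₄ = α₄)
    (hα₆ : PadicInt.toZMod A₆ = α₆)
    (hgood : ∀ x : ZMod p, x ^ 3 + α₂ * x ^ 2 + α₄ * x + α₆ = 0 →
      3 * x ^ 2 + 2 * α₂ * x + α₄ ≠ 0) :
    Finite (AddCommGroup.torsion W.Point) ∧
      Nat.card (AddCommGroup.torsion W.Point) ≤ (Finset.univ.filter fun q : ZMod p × ZMod p =>
        q.2 ^ 2 = q.1 ^ 3 + α₂ * q.1 ^ 2 + α₄ * q.1 + α₆).card + 1 := by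
  have H : IsShortIntegral φ W := ⟨h₁, h₃, by rw [h₂]; exact A₂.2, by rw [h₄]; exact A₄.2,
    by rw [h₆]; exact A₆.2⟩
  have hnorm2 : ‖(2 : ℚ_[p])‖ = 1 := by
    have hcop : p.Coprime 2 := (Nat.coprime_primes Fact.out Nat.prime_two).mpr hp
    exact_mod_cast (Padic.norm_natCast_eq_one_iff (p := p) (n := 2)).mpr hcop
  have hgood' : ∀ x : ℚ_[p], ‖x‖ ≤ 1 →
      ‖x ^ 3 + φ W.a₂ * x ^ 2 + φ W.a₄ * x + φ W.a₆‖ < 1 →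
      ‖3 * x ^ 2 + 2 * φ W.a₂ * x + φ W.a₄‖ = 1 := by
    intro x hx hfx
    obtain ⟨x, rfl, -⟩ := Padic.exists_coe_eq_and_toZMod_eq x hx
    rw [h₂, h₄, h₆] at hfx
    rw [h₂, h₄]
    have e : (PadicInt.toZMod (x ^ 3 + A₂ * x ^ 2 + A₄ * x + A₆)) = 0 := by
      rw [PadicInt.toZMod_eq_zero_iff, PadicInt.norm_def]
      exact_mod_cast hfx
    have e' := mt (PadicInt.toZMod_eq_zero_iff (3 * x ^ 2 + 2 * A₂ * x + A₄)).mpr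
    simp only [map_add, map_mul, map_pow, map_ofNat, hα₂, hα₄, hα₆] at e e'
    have := e' (hgood _ e)
    rw [PadicInt.norm_def, not_lt] at this
    refine le_antisymm ?_ (by exact_mod_cast this)
    exact_mod_cast (3 * x ^ 2 + 2 * A₂ * x + A₄).2
  have hyint : ∀ {x y : K}, W.Equation x y → ‖φ x‖ ≤ 1 → ‖φ y‖ ≤ 1 := by
    intro x y h hx
    have := norm_cubic_le_one H.a₂ H.a₄ H.a₆ hx
    rw [← H.equation h, norm_pow] at this
    exact (pow_le_one_iff_of_nonneg (norm_nonneg _) two_ne_zero).mp this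
  let S := {q : ZMod p × ZMod p // q.2 ^ 2 = q.1 ^ 3 + α₂ * q.1 ^ 2 + α₄ * q.1 + α₆}
  have hred : ∀ {x y : K} (h : W.Nonsingular x y) (hx : ‖φ x‖ ≤ 1),
      Padic.residue (φ y) (hyint h.1 hx) ^ 2 = Padic.residue (φ x) hx ^ 3 +
        α₂ * Padic.residue (φ x) hx ^ 2 + α₄ * Padic.residue (φ x) hx + α₆ := by
    intro x y h hx
    obtain ⟨X, hX, hX'⟩ := Padic.exists_coe_eq_and_toZMod_eq (φ x) hx
    obtain ⟨Y, hY, hY'⟩ := Padic.exists_coe_eq_and_toZMod_eq (φ y) (hyint h.1 hx)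
    have e := H.equation h.1
    rw [h₂, h₄, h₆, ← hX, ← hY] at e
    have e' : Y ^ 2 = X ^ 3 + A₂ * X ^ 2 + A₄ * X + A₆ :=
      PadicInt.ext (by push_cast; exact e)
    simpa [hα₂, hα₄, hα₆, hX', hY'] using congrArg PadicInt.toZMod e'
  -- reduction modulo `p`, with `none` for the point at infinity
  let red : W.Point → Option S := fun P => match P with
    | .zero => none
    | .some x y h => if hx : ‖φ x‖ ≤ 1 then
        some ⟨(Padic.residue (φ x) hx, Padic.residue (φ y) (hyint h.1 hx)), hred h hx⟩
      else none
  have hker : ∀ P : W.Point, red P = none → P.InReductionKernel φ := by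
    rintro (_ | ⟨x, y, h⟩) hP
    · trivial
    · by_contra hc
      simp [red, not_lt.mp hc] at hP
  have hclose : ∀ {u v : ℚ_[p]} (hu : ‖u‖ ≤ 1) (hv : ‖v‖ ≤ 1),
      Padic.residue u hu = Padic.residue v hv → ‖u - v‖ < 1 := by
    intro u v hu hv h
    obtain ⟨U, rfl, hU⟩ := Padic.exists_coe_eq_and_toZMod_eq u hu
    obtain ⟨V, rfl, hV⟩ := Padic.exists_coe_eq_and_toZMod_eq v hv
    rw [← hU, ← hV, ← sub_eq_zero, ← map_sub, PadicInt.toZMod_eq_zero_iff] at h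
    exact_mod_cast h
  have hinj : Function.Injective fun P : AddCommGroup.torsion W.Point => red P := by
    rintro ⟨P, hP⟩ ⟨Q, hQ⟩ hPQ
    simp only at hPQ
    rw [Subtype.mk.injEq]
    rcases hr : red Q with _ | s
    · rw [hr] at hPQ
      rw [H.eq_zero_of_isOfFinAddOrder (hker P hPQ) hP, H.eq_zero_of_isOfFinAddOrder (hker Q hr) hQ]
    · rw [hr] at hPQ
      have hsub : (P - Q).InReductionKernel φ := by
        rcases P with _ | ⟨x₁, y₁, n₁⟩
        · simp [red] at hPQ
        rcases Q with _ | ⟨x₂, y₂, n₂⟩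
        · simp [red] at hr
        by_cases hx₁ : ‖φ x₁‖ ≤ 1
        swap
        · simp [red, hx₁] at hPQ
        by_cases hx₂ : ‖φ x₂‖ ≤ 1
        swap
        · simp [red, hx₂] at hr
        simp only [red, hx₁, hx₂, dif_pos, Option.some.injEq] at hPQ hr
        rw [← hr, Subtype.mk.injEq, Prod.mk.injEq] at hPQ
        exact H.sub_mem_of_norm_sub_lt hnorm2 hgood' n₁ n₂ hx₁ hx₂ (hclose _ _ hPQ.1)
          (hclose _ _ hPQ.2)
      exact sub_eq_zero.mp
        (H.eq_zero_of_isOfFinAddOrder hsub ((AddCommGroup.torsion W.Point).sub_mem hP hQ))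
  refine ⟨Finite.of_injective _ hinj, (Nat.card_le_card_of_injective _ hinj).trans_eq ?_⟩
  rw [Finite.card_option, Nat.card_eq_fintype_card, Fintype.card_subtype]

end Reduction

/-! ### The four-torsion -/

section FourTorsion

/-- An abelian group of order at most `16` containing two elements killed by `4` whose doubles are
distinct and nonzero is `ℤ/4ℤ × ℤ/4ℤ`. -/
theorem nonempty_addEquiv_zmod_four_prod {A : Type*} [AddCommGroup A] [Finite A]
    (hcard : Nat.card A ≤ 16) {P Q : A} (hP : 4 • P = 0) (hQ : 4 • Q = 0) (hP2 : 2 • P ≠ 0)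
    (hQ2 : 2 • Q ≠ 0) (hPQ : 2 • P ≠ 2 • Q) : Nonempty (A ≃+ ZMod 4 × ZMod 4) := by
  have hP' : (4 : ℤ) • P = 0 := by exact_mod_cast hP
  have hQ' : (4 : ℤ) • Q = 0 := by exact_mod_cast hQ
  -- a relation between `2 P` and `2 Q` has even coefficients
  have key : ∀ k l : ℤ, (2 * k) • P + (2 * l) • Q = 0 → Even k ∧ Even l := by
    intro k l h
    rcases Int.even_or_odd' k with ⟨k', rfl | rfl⟩ <;>
      rcases Int.even_or_odd' l with ⟨l', rfl | rfl⟩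
    · simp
    · refine absurd ?_ hQ2
      linear_combination (norm := module) h - k' • hP' - l' • hQ'
    · refine absurd ?_ hP2
      linear_combination (norm := module) h - k' • hP' - l' • hQ'
    · refine absurd ?_ hPQ
      linear_combination (norm := module) h - k' • hP' - (l' + 1) • hQ'
  have key' : ∀ k l : ℤ, k • P + l • Q = 0 → (4 : ℤ) ∣ k ∧ (4 : ℤ) ∣ l := by
    intro k l h
    obtain ⟨⟨k', rfl⟩, ⟨l', rfl⟩⟩ := key k l (by
      linear_combination (norm := module) (2 : ℤ) • h)
    obtain ⟨⟨k', rfl⟩, ⟨l', rfl⟩⟩ := key k' l' (by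
      linear_combination (norm := module) h)
    exact ⟨⟨k', by ring⟩, ⟨l', by ring⟩⟩
  let f : ZMod 4 →+ A := ZMod.lift 4 ⟨zmultiplesHom A P, by simpa using hP'⟩
  let g : ZMod 4 →+ A := ZMod.lift 4 ⟨zmultiplesHom A Q, by simpa using hQ'⟩
  have hinj : Function.Injective (f.coprod g) := by
    rw [injective_iff_map_eq_zero]
    rintro ⟨m, n⟩ h
    obtain ⟨k, rfl⟩ := ZMod.intCast_surjective m
    obtain ⟨l, rfl⟩ := ZMod.intCast_surjective n
    have h' : k • P + l • Q = 0 := by simpa [f, g] using h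
    obtain ⟨hk, hl⟩ := key' k l h'
    rw [Prod.mk_eq_zero]
    exact ⟨(ZMod.intCast_zmod_eq_zero_iff_dvd k 4).mpr hk,
      (ZMod.intCast_zmod_eq_zero_iff_dvd l 4).mpr hl⟩
  have hbij := hinj.bijective_of_nat_card_le (by simpa using hcard)
  exact ⟨(AddEquiv.ofBijective _ hbij).symm⟩

open WeierstrassCurve.Affine WeierstrassCurve.Affine.Point

variable {K : Type*} [Field K]

/-- If the other two roots of the cubic are `e - s²` and `e - t²`, then the point `(e, 0)` is the double
of `(e + s t, s t (s + t))`, where the tangent has slope `s + t`. -/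
theorem two_nsmul_eq_of_shift_squares [DecidableEq K] {W : WeierstrassCurve.Affine K}
    (h₁ : W.a₁ = 0) (h₃ : W.a₃ = 0) {e s t : K} (h2 : (2 : K) ≠ 0) (hs : s ≠ 0) (ht : t ≠ 0)
    (hst : s + t ≠ 0) (h₂ : W.a₂ = -(e + (e - s ^ 2) + (e - t ^ 2)))
    (h₄ : W.a₄ = e * (e - s ^ 2) + e * (e - t ^ 2) + (e - s ^ 2) * (e - t ^ 2))
    (n : W.Nonsingular (e + s * t) (s * t * (s + t))) (n' : W.Nonsingular e 0) :
    2 • Point.some _ _ n = Point.some e 0 n' := by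
  have hy : s * t * (s + t) ≠ 0 := mul_ne_zero (mul_ne_zero hs ht) hst
  have h2y : 2 * (s * t * (s + t)) ≠ 0 := mul_ne_zero h2 hy
  obtain ⟨ℓ, m, x₃, n₃, hadd, l, -, s₁, -, -, htan⟩ := exists_chord h₁ h₃ n n
    (fun h => h2y (by linear_combination h.2))
  have hℓ : ℓ = s + t := by
    refine mul_left_cancel₀ h2y ?_
    rw [(htan rfl).2, h₂, h₄]
    ring
  rw [two_nsmul, hadd, Point.some.injEq]
  have hx : x₃ = e := by
    rw [hℓ, h₂] at s₁
    linear_combination s₁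
  refine ⟨hx, ?_⟩
  rw [hx]
  rw [hℓ] at l ⊢
  linear_combination l

theorem two_nsmul_of_y_eq_zero [DecidableEq K] {W : WeierstrassCurve.Affine K}
    (h₁ : W.a₁ = 0) (h₃ : W.a₃ = 0) {e : K} (n : W.Nonsingular e 0) :
    2 • Point.some e 0 n = 0 := by
  rw [two_nsmul]
  exact add_self_of_Y_eq (by rw [negY_of_short h₁ h₃, _root_.neg_zero])

/-- If the roots of the cubic differ by squares and `-1` is a square, then every point of order two is a
double, so the full four-torsion is rational; a bound by `16` then leaves no room for more torsion. -/
theorem hasTorsion_four_four_of_squares {a b c ι p q r : K} (h2 : (2 : K) ≠ 0) (hι : ι ^ 2 = -1)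
    [(inducedCurve a b c).IsElliptic] (hp : b * c - a * b = p ^ 2) (hq : a * c - a * b = q ^ 2)
    (hr : a * c - b * c = r ^ 2) (hp0 : p ≠ 0) (hq0 : q ≠ 0) (hr0 : r ≠ 0)
    (hT : ∀ [DecidableEq K], Finite (AddCommGroup.torsion (inducedCurve a b c).Point) ∧
      Nat.card (AddCommGroup.torsion (inducedCurve a b c).Point) ≤ 16) :
    HasTorsion (inducedCurve a b c) 4 4 := by
  classical
  have hι0 : ι ≠ 0 := by rintro rfl; simp at hι
  have hιp : ι * p ≠ 0 := mul_ne_zero hι0 hp0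
  have hpq : p + q ≠ 0 := fun h => pow_ne_zero 2 hr0 (by
    linear_combination (q - p) * h - hr - hp + hq)
  have hιpr : ι * p + r ≠ 0 := fun h => pow_ne_zero 2 hq0 (by
    linear_combination -(ι * p - r) * h - hq + hp + hr + p ^ 2 * hι)
  have hns : ∀ {x y : K}, y ^ 2 = (x + a * b) * (x + b * c) * (x + a * c) →
      (inducedCurve a b c).Nonsingular x y := fun h =>
    (equation_iff_nonsingular).mp ((inducedCurve_equation_iff a b c _ _).mpr h)
  have nT₁ : (inducedCurve a b c).Nonsingular (-(a * b)) 0 := hns (by ring)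
  have nT₂ : (inducedCurve a b c).Nonsingular (-(b * c)) 0 := hns (by ring)
  have nP : (inducedCurve a b c).Nonsingular (-(a * b) + p * q) (p * q * (p + q)) := hns (by
    rw [show b * c = a * b + p ^ 2 by linear_combination hp,
      show a * c = a * b + q ^ 2 by linear_combination hq]
    ring)
  have nQ : (inducedCurve a b c).Nonsingular (-(b * c) + ι * p * r)
      (ι * p * r * (ι * p + r)) := hns (by
    rw [show a * b = b * c + (ι * p) ^ 2 by linear_combination -hp - p ^ 2 * hι,
      show a * c = b * c + r ^ 2 by linear_combination hr]
    ring)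
  -- `(-ab, 0)` and `(-bc, 0)` are halved; the differences of `-bc` with the other two roots are
  -- `(ι p)²` and `r²`
  have dP : 2 • Point.some _ _ nP = Point.some _ _ nT₁ :=
    two_nsmul_eq_of_shift_squares rfl rfl h2 hp0 hq0 hpq
      (by rw [← hp, ← hq]; simp only [inducedCurve]; ring)
      (by rw [← hp, ← hq]; simp only [inducedCurve]; ring) nP nT₁
  have hιp2 : (ι * p) ^ 2 = a * b - b * c := by linear_combination p ^ 2 * hι + hp
  have dQ : 2 • Point.some _ _ nQ = Point.some _ _ nT₂ :=
    two_nsmul_eq_of_shift_squares rfl rfl h2 hιp hr0 hιpr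
      (by rw [hιp2, ← hr]; simp only [inducedCurve]; ring)
      (by rw [hιp2, ← hr]; simp only [inducedCurve]; ring) nQ nT₂
  have fP : 4 • Point.some _ _ nP = 0 := by
    rw [show 4 = 2 * 2 from rfl, mul_nsmul, dP, two_nsmul_of_y_eq_zero rfl rfl]
  have fQ : 4 • Point.some _ _ nQ = 0 := by
    rw [show 4 = 2 * 2 from rfl, mul_nsmul, dQ, two_nsmul_of_y_eq_zero rfl rfl]
  have tP : Point.some _ _ nP ∈ AddCommGroup.torsion (inducedCurve a b c).Point :=
    isOfFinAddOrder_iff_nsmul_eq_zero.mpr ⟨4, by norm_num, fP⟩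
  have tQ : Point.some _ _ nQ ∈ AddCommGroup.torsion (inducedCurve a b c).Point :=
    isOfFinAddOrder_iff_nsmul_eq_zero.mpr ⟨4, by norm_num, fQ⟩
  obtain ⟨hfin, hcard⟩ := hT
  refine nonempty_addEquiv_zmod_four_prod hcard (P := ⟨_, tP⟩) (Q := ⟨_, tQ⟩) (Subtype.ext fP)
    (Subtype.ext fQ) (fun h => ?_) (fun h => ?_) (fun h => ?_)
  · exact some_ne_zero _ (dP.symm.trans (congrArg Subtype.val h))
  · exact some_ne_zero _ (dQ.symm.trans (congrArg Subtype.val h))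
  · have h' := dP.symm.trans ((congrArg Subtype.val h).trans dQ)
    rw [Point.some.injEq] at h'
    exact pow_ne_zero 2 hp0 (by linear_combination -hp + h'.1)

/-- When all torsion is killed by `4`, the point `(0, abc)` can only be torsion if its double has
`y`-coordinate zero. The tangent at `(0, abc)` has slope `(a + b + c) / 2`, and the condition becomes
`(b + c - a)(a + c - b)(a + b - c) = 0`. -/
theorem isPointOfInfiniteOrder_zero_mul {a b c : K} (h2 : (2 : K) ≠ 0) (ha : a ≠ 0) (hb : b ≠ 0)
    (hc : c ≠ 0) [(inducedCurve a b c).IsElliptic] (hT : HasTorsion (inducedCurve a b c) 4 4)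
    (hbc : b + c ≠ a) (hac : a + c ≠ b) (hab : a + b ≠ c) :
    IsPointOfInfiniteOrder (inducedCurve a b c) 0 (a * b * c) := by
  classical
  have n : (inducedCurve a b c).Nonsingular 0 (a * b * c) :=
    (equation_iff_nonsingular).mp ((inducedCurve_equation_iff a b c _ _).mpr (by ring))
  refine ⟨n, fun hfin => ?_⟩
  obtain ⟨e⟩ := hT
  have h4 : 4 • Point.some _ _ n = 0 := by
    have hz : ∀ z : ZMod 4 × ZMod 4, 4 • z = 0 := by decide
    have : 4 • (⟨_, hfin⟩ : AddCommGroup.torsion (inducedCurve a b c).Point) = 0 :=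
      e.injective (by rw [map_nsmul, hz, _root_.map_zero])
    exact congrArg Subtype.val this
  have hy : a * b * c ≠ 0 := mul_ne_zero (mul_ne_zero ha hb) hc
  obtain ⟨ℓ, m, x₃, n₃, hadd, l, -, s₁, -, -, htan⟩ := exists_chord rfl rfl n n
    (fun h => mul_ne_zero h2 hy (by linear_combination h.2))
  rw [show 4 = 2 * 2 from rfl, mul_nsmul, two_nsmul (Point.some _ _ n), hadd, two_nsmul] at h4
  have hy₃ : ℓ * x₃ + m = 0 := by
    by_contra hne
    obtain ⟨_, _, _, _, hadd', -⟩ := exists_chord rfl rfl n₃ n₃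
      (fun h => mul_ne_zero h2 hne (by linear_combination -h.2))
    exact some_ne_zero _ (hadd'.symm.trans h4)
  have hℓ : 2 * ℓ = a + b + c := by
    refine mul_left_cancel₀ hy ?_
    have := (htan rfl).2
    simp only [inducedCurve] at this
    linear_combination this
  simp only [inducedCurve] at s₁
  have : (b + c - a) * (a + c - b) * (a + b - c) = 0 := by
    linear_combination -8 * hy₃ + 8 * ℓ * s₁ - 8 * l + ((a + b + c) ^ 2 + (a + b + c) * (2 * ℓ) +
      (2 * ℓ) ^ 2 - 4 * (a * b + b * c + a * c)) * hℓ
  simp [sub_eq_zero, hbc, hac, hab] at this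

theorem hasPositiveRank_of_infinite_order {W : WeierstrassCurve.Affine K} {x y : K}
    (h : IsPointOfInfiniteOrder W x y) : HasPositiveRank W := by
  classical
  obtain ⟨n, hn⟩ := h
  unfold HasPositiveRank
  rw [pos_iff_ne_zero, ne_eq, rank_eq_zero_iff]
  intro h
  obtain ⟨k, hk, hk'⟩ := h (Point.some x y n)
  exact hn (isOfFinAddOrder_iff_zsmul_eq_zero.mpr ⟨k, hk, hk'⟩)

end FourTorsion

/-! ### Embeddings into `ℚ_[13]` -/

section Family

instance fact_prime_thirteen : Fact (Nat.Prime 13) := ⟨by norm_num⟩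

/-- Hensel lifting of `5 ^ 2 = -1` modulo `13`. -/
theorem exists_sq_eq_neg_one_padic : ∃ z : ℤ_[13], z ^ 2 = -1 := by
  have h := hensels_lemma (p := 13) (R := ℤ_[13]) (F := (Polynomial.X ^ 2 + 1 : Polynomial ℤ_[13]))
    (a := 5) (by
      have h1 : (Polynomial.aeval (5 : ℤ_[13])) (Polynomial.X ^ 2 + 1 : Polynomial ℤ_[13]) =
        ((13 : ℕ) : ℤ_[13]) * 2 := by simp; norm_num
      have h2 : (Polynomial.aeval (5 : ℤ_[13]))
        (Polynomial.derivative (Polynomial.X ^ 2 + 1 : Polynomial ℤ_[13])) = (10 : ℕ) := by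
        simp; norm_num
      have h3 : ‖((10 : ℕ) : ℤ_[13])‖ = 1 := by
        rw [PadicInt.norm_natCast_eq_one_iff]; norm_num
      rw [h1, h2, h3, one_pow, PadicInt.norm_lt_one_iff_dvd]
      exact dvd_mul_right _ _)
  obtain ⟨z, hz, -⟩ := h
  refine ⟨z, ?_⟩
  simp at hz
  linear_combination hz

theorem exists_ringHom_padic : Nonempty (QI →+* ℚ_[13]) := by
  obtain ⟨z, hz⟩ := exists_sq_eq_neg_one_padic
  have hdvd : minpoly ℚ Complex.I ∣ Polynomial.X ^ 2 + 1 := minpoly.dvd _ _ (by simp)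
  have hfac : (Polynomial.X ^ 2 + 1 : Polynomial ℚ).map (algebraMap ℚ ℚ_[13]) =
      (Polynomial.X - Polynomial.C (z : ℚ_[13])) * (Polynomial.X - Polynomial.C (-(z : ℚ_[13]))) := by
    have hz' : (z : ℚ_[13]) ^ 2 = -1 := by exact_mod_cast congrArg ((↑) : ℤ_[13] → ℚ_[13]) hz
    have hC : (Polynomial.C (z : ℚ_[13])) ^ 2 = -1 := by rw [← map_pow, hz']; simp
    simp only [Polynomial.map_add, Polynomial.map_pow, Polynomial.map_X, Polynomial.map_one,
      map_neg]
    linear_combination hC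
  have hne : (Polynomial.X ^ 2 + 1 : Polynomial ℚ).map (algebraMap ℚ ℚ_[13]) ≠ 0 := by
    rw [hfac]
    exact mul_ne_zero (Polynomial.X_sub_C_ne_zero _) (Polynomial.X_sub_C_ne_zero _)
  have hsplit : ((minpoly ℚ Complex.I).map (algebraMap ℚ ℚ_[13])).Splits := by
    refine Polynomial.Splits.of_dvd ?_ hne (Polynomial.map_dvd _ hdvd)
    rw [hfac]
    exact (Polynomial.Splits.X_sub_C _).mul (Polynomial.Splits.X_sub_C _)
  obtain ⟨f⟩ : Nonempty (QI →ₐ[ℚ] ℚ_[13]) := by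
    refine IntermediateField.nonempty_algHom_adjoin_of_splits ?_
    rintro _ rfl
    exact ⟨Complex.isIntegral_rat_I, hsplit⟩
  exact ⟨f.toRingHom⟩

theorem exists_sq_eq_neg_one_QI : ∃ ι : QI, ι ^ 2 = -1 := by
  refine ⟨⟨Complex.I, IntermediateField.mem_adjoin_simple_self ℚ Complex.I⟩, ?_⟩
  ext
  simp

/-- `ℚ(i)(t)` embeds into `ℚ_[13]` with `t` mapped to an integer congruent to `2`. Since `ℚ_[13]` is
uncountable, it contains an element that is transcendental over the countable field `ℚ(i)`; by
inversion it may be taken integral, and then moved into the residue class of `2`. -/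
theorem exists_ringHom_ratFunc_padic (φ : QI →+* ℚ_[13]) :
    ∃ (ψ : RatFunc QI →+* ℚ_[13]) (T : ℤ_[13]), ψ RatFunc.X = T ∧ PadicInt.toZMod T = 2 := by
  let _ := φ.toAlgebra
  have htr : ∃ τ : ℚ_[13], Transcendental QI τ := by
    by_contra! hc
    have halg : Algebra.IsAlgebraic QI ℚ_[13] := ⟨fun τ => by simpa [Transcendental] using hc τ⟩
    have hQI : Cardinal.mk QI ≤ Cardinal.aleph0 := by
      have : Algebra.IsAlgebraic ℚ QI := by
        exact IntermediateField.isAlgebraic_adjoin_simple Complex.isIntegral_rat_I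
      simpa using Algebra.IsAlgebraic.cardinalMk_le_max ℚ QI
    have h1 : Cardinal.mk ℚ_[13] ≤ Cardinal.aleph0 :=
      (Algebra.IsAlgebraic.cardinalMk_le_max QI ℚ_[13]).trans (max_le hQI le_rfl)
    have h2 := continuum_le_cardinal_of_nontriviallyNormedField ℚ_[13]
    exact absurd (h2.trans h1) (not_le.mpr Cardinal.aleph0_lt_continuum)
  have htr' : ∃ T : ℤ_[13], PadicInt.toZMod T = 2 ∧ Transcendental QI (T : ℚ_[13]) := by
    obtain ⟨τ, hτ⟩ := htr
    have hs : ∃ s : ℤ_[13], Transcendental QI (s : ℚ_[13]) := by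
      by_cases h : ‖τ‖ ≤ 1
      · exact ⟨⟨τ, h⟩, hτ⟩
      · refine ⟨⟨τ⁻¹, ?_⟩, fun hal => hτ (IsAlgebraic.inv_iff.mp hal)⟩
        rw [norm_inv]
        exact inv_le_one_of_one_le₀ (not_le.mp h).le
    obtain ⟨s, hs⟩ := hs
    refine ⟨2 + 13 * s, ?_, fun hal => hs ?_⟩
    · have h13 : (13 : ZMod 13) = 0 := by decide
      rw [map_add, map_mul, map_ofNat, map_ofNat, h13, zero_mul, add_zero]
    · have h2 : IsAlgebraic QI (2 : ℚ_[13]) := by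
        exact map_ofNat (algebraMap QI ℚ_[13]) 2 ▸ isAlgebraic_algebraMap (2 : QI)
      have h13 : IsAlgebraic QI (13 : ℚ_[13]) :=
        map_ofNat (algebraMap QI ℚ_[13]) 13 ▸ isAlgebraic_algebraMap (13 : QI)
      have h0 : (13 : ℚ_[13]) ≠ 0 := by norm_num
      have hs' : (s : ℚ_[13]) = 13⁻¹ * (((2 + 13 * s : ℤ_[13]) : ℚ_[13]) - 2) := by
        rw [PadicInt.coe_add, PadicInt.coe_mul, eq_inv_mul_iff_mul_eq₀ h0]
        change _ = 2 + 13 * (s : ℚ_[13]) - 2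
        ring
      rw [hs']
      exact h13.inv.mul (hal.sub h2)
  obtain ⟨T, hT, htrT⟩ := htr'
  have hinj : Function.Injective (Polynomial.aeval (R := QI) (T : ℚ_[13])) :=
    transcendental_iff_injective.mp htrT
  refine ⟨IsFractionRing.lift (A := Polynomial QI) (K := RatFunc QI)
    (g := (Polynomial.aeval (R := QI) (T : ℚ_[13])).toRingHom) hinj, T, ?_, hT⟩
  rw [← RatFunc.algebraMap_X, IsFractionRing.lift_algebraMap]
  simp

/-! ### Residue classes -/

/-- `x` is integral for the embedding `φ` and its residue class modulo `p` is `r`. -/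
def HasResidue {K : Type*} [Field K] {p : ℕ} [Fact p.Prime] (φ : K →+* ℚ_[p]) (x : K)
    (r : ZMod p) : Prop :=
  ∃ X : ℤ_[p], φ x = X ∧ PadicInt.toZMod X = r

namespace HasResidue

variable {K : Type*} [Field K] {p : ℕ} [Fact p.Prime] {φ : K →+* ℚ_[p]} {x y : K} {r s : ZMod p}

theorem ofNat (φ : K →+* ℚ_[p]) (n : ℕ) [n.AtLeastTwo] :
    HasResidue φ (OfNat.ofNat n : K) (OfNat.ofNat n) :=
  ⟨OfNat.ofNat n, by rw [map_ofNat]; rfl, map_ofNat _ n⟩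

theorem one (φ : K →+* ℚ_[p]) : HasResidue φ (1 : K) 1 := ⟨1, by simp, map_one _⟩

theorem add (hx : HasResidue φ x r) (hy : HasResidue φ y s) : HasResidue φ (x + y) (r + s) := by
  obtain ⟨X, hX, rfl⟩ := hx
  obtain ⟨Y, hY, rfl⟩ := hy
  exact ⟨X + Y, by simp [hX, hY], map_add _ _ _⟩

theorem sub (hx : HasResidue φ x r) (hy : HasResidue φ y s) : HasResidue φ (x - y) (r - s) := by
  obtain ⟨X, hX, rfl⟩ := hx
  obtain ⟨Y, hY, rfl⟩ := hy
  exact ⟨X - Y, by simp [hX, hY], map_sub _ _ _⟩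

theorem neg (hx : HasResidue φ x r) : HasResidue φ (-x) (-r) := by
  obtain ⟨X, hX, rfl⟩ := hx
  exact ⟨-X, by simp [hX], map_neg _ _⟩

theorem mul (hx : HasResidue φ x r) (hy : HasResidue φ y s) : HasResidue φ (x * y) (r * s) := by
  obtain ⟨X, hX, rfl⟩ := hx
  obtain ⟨Y, hY, rfl⟩ := hy
  exact ⟨X * Y, by simp [hX, hY], map_mul _ _ _⟩

theorem pow (hx : HasResidue φ x r) (n : ℕ) : HasResidue φ (x ^ n) (r ^ n) := by
  obtain ⟨X, hX, rfl⟩ := hx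
  exact ⟨X ^ n, by simp [hX], map_pow _ _ _⟩

theorem ne_zero (hx : HasResidue φ x r) (hr : r ≠ 0) : x ≠ 0 := by
  rintro rfl
  obtain ⟨X, hX, rfl⟩ := hx
  rw [map_zero] at hX
  have : X = 0 := PadicInt.ext hX.symm
  exact hr (by rw [this, map_zero])

theorem ne (hx : HasResidue φ x r) (hy : HasResidue φ y s) (h : r ≠ s) : x ≠ y :=
  sub_ne_zero.mp ((hx.sub hy).ne_zero (sub_ne_zero.mpr h))

theorem div (hx : HasResidue φ x r) (hy : HasResidue φ y s) (hs : s ≠ 0) :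
    HasResidue φ (x / y) (r / s) := by
  obtain ⟨X, hX, rfl⟩ := hx
  obtain ⟨Y, hY, rfl⟩ := hy
  have hunit : IsUnit Y := by
    rw [PadicInt.isUnit_iff]
    refine le_antisymm Y.2 (not_lt.mp fun h => hs ?_)
    exact (PadicInt.toZMod_eq_zero_iff Y).mpr h
  obtain ⟨Z, hZ⟩ := hunit.exists_right_inv
  have hZ' : (Y : ℚ_[p]) * Z = 1 := by exact_mod_cast congrArg ((↑) : ℤ_[p] → ℚ_[p]) hZ
  have hZr : PadicInt.toZMod Y * PadicInt.toZMod Z = 1 := by rw [← map_mul, hZ, map_one]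
  refine ⟨X * Z, ?_, ?_⟩
  · rw [map_div₀, hX, hY, PadicInt.coe_mul, div_eq_iff (left_ne_zero_of_mul_eq_one hZ')]
    linear_combination -(X : ℚ_[p]) * hZ'
  · rw [map_mul, eq_div_iff hs]
    linear_combination PadicInt.toZMod X * hZr

end HasResidue

/-! ### The family of triples -/

section Member

variable {K : Type*} [Field K] {φ : K →+* ℚ_[13]} {t a b c : K}

/-- The explicit square roots that make `{a, b, c}` a Diophantine triple and the roots of the cubic differ
by squares. Here `n` and `d` abbreviate the two recurring factors of the parametrization. -/
theorem family_identities {n d : K} (hn : n = t ^ 4 + 2 * t ^ 2 + 5)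
    (hd : d = 3 * t ^ 4 + 6 * t ^ 2 - 1) (ht0 : t ≠ 0) (hn0 : n ≠ 0) (hd0 : d ≠ 0)
    (ha : a = t * n / d) (hb : b = -1 / a)
    (hc : c = 16 * t * (t ^ 4 - 1) * (t ^ 2 - 1) / (n * d)) :
    a * b + 1 = 0 ∧ a * c + 1 = ((5 * t ^ 4 + 2 * t ^ 2 + 1) / d) ^ 2 ∧
      b * c + 1 = ((t ^ 4 - 6 * t ^ 2 - 3) / n) ^ 2 ∧
      a * c - b * c = (4 * (t ^ 4 - 1) * (t ^ 4 + 6 * t ^ 2 + 1) / (n * d)) ^ 2 := by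
  refine ⟨?_, ?_, ?_, ?_⟩
  · rw [hb, ha]; field_simp; ring
  · rw [ha, hc]; field_simp; rw [hd]; ring
  · rw [hb, ha, hc]; field_simp; rw [hn]; ring
  · rw [hb, ha, hc]; field_simp; rw [hn, hd]; ring

/-- The members of the triple with denominators cleared. -/
theorem family_linear {n d : K} (ht0 : t ≠ 0) (hn0 : n ≠ 0) (hd0 : d ≠ 0)
    (ha : a = t * n / d) (hb : b = -1 / a)
    (hc : c = 16 * t * (t ^ 4 - 1) * (t ^ 2 - 1) / (n * d)) :
    t * n * d * a = t ^ 2 * n ^ 2 ∧ t * n * d * b = -d ^ 2 ∧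
      t * n * d * c = 16 * t ^ 2 * (t ^ 4 - 1) * (t ^ 2 - 1) := by
  refine ⟨?_, ?_, ?_⟩
  · rw [ha]; field_simp
  · rw [hb, ha]; field_simp
  · rw [hc]; field_simp

/-- At `t ≡ 2` modulo `13` the triple is `(1, -1, 2)` modulo `13`. -/
theorem family_residues (ht : HasResidue φ t 2)
    (ha : a = t * (t ^ 4 + 2 * t ^ 2 + 5) / (3 * t ^ 4 + 6 * t ^ 2 - 1)) (hb : b = -1 / a)
    (hc : c = 16 * t * (t ^ 4 - 1) * (t ^ 2 - 1) /
        ((t ^ 4 + 2 * t ^ 2 + 5) * (3 * t ^ 4 + 6 * t ^ 2 - 1))) :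
    HasResidue φ (t ^ 4 + 2 * t ^ 2 + 5) 3 ∧ HasResidue φ (3 * t ^ 4 + 6 * t ^ 2 - 1) 6 ∧
      HasResidue φ a 1 ∧ HasResidue φ b (-1) ∧ HasResidue φ c 2 := by
  have hn : HasResidue φ (t ^ 4 + 2 * t ^ 2 + 5) 3 :=
    ((ht.pow 4).add ((HasResidue.ofNat φ 2).mul (ht.pow 2))).add (.ofNat φ 5)
  have hd : HasResidue φ (3 * t ^ 4 + 6 * t ^ 2 - 1) 6 :=
    (((HasResidue.ofNat φ 3).mul (ht.pow 4)).add ((HasResidue.ofNat φ 6).mul (ht.pow 2))).sub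
      (.one φ)
  have hra : HasResidue φ a 1 := by
    have := (ht.mul hn).div hd (by decide)
    rwa [← ha, show (2 : ZMod 13) * 3 / 6 = 1 by rw [div_eq_iff (by decide)]; decide] at this
  have hrb : HasResidue φ b (-1) := by
    have := (HasResidue.one φ).neg.div hra (by decide)
    rwa [← hb, div_one] at this
  have hrc : HasResidue φ c 2 := by
    have := ((((HasResidue.ofNat φ 16).mul ht).mul ((ht.pow 4).sub (.one φ))).mul
      ((ht.pow 2).sub (.one φ))).div (hn.mul hd) (by decide)
    rwa [← hc, show (OfNat.ofNat 16 : ZMod 13) * 2 * (2 ^ 4 - 1) * (2 ^ 2 - 1) / (3 * 6) = 2 by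
      rw [div_eq_iff (by decide)]; decide] at this
  exact ⟨hn, hd, hra, hrb, hrc⟩

theorem family_isDiophantineTriple (ht : HasResidue φ t 2)
    (ha : a = t * (t ^ 4 + 2 * t ^ 2 + 5) / (3 * t ^ 4 + 6 * t ^ 2 - 1)) (hb : b = -1 / a)
    (hc : c = 16 * t * (t ^ 4 - 1) * (t ^ 2 - 1) /
        ((t ^ 4 + 2 * t ^ 2 + 5) * (3 * t ^ 4 + 6 * t ^ 2 - 1))) :
    IsDiophantineTriple a b c := by
  obtain ⟨hn, hd, hra, hrb, hrc⟩ := family_residues ht ha hb hc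
  have ht0 := ht.ne_zero (by decide)
  have hn0 := hn.ne_zero (by decide)
  have hd0 := hd.ne_zero (by decide)
  have ha0 := hra.ne_zero (by decide)
  obtain ⟨h₁, h₂, h₃, -⟩ := family_identities rfl rfl ht0 hn0 hd0 ha hb hc
  refine ⟨ha0, hrb.ne_zero (by decide), hrc.ne_zero (by decide), hra.ne hrb (by decide),
    hra.ne hrc (by decide), hrb.ne hrc (by decide), ⟨0, ?_⟩,
    ⟨(5 * t ^ 4 + 2 * t ^ 2 + 1) / (3 * t ^ 4 + 6 * t ^ 2 - 1), ?_⟩,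
    ⟨(t ^ 4 - 6 * t ^ 2 - 3) / (t ^ 4 + 2 * t ^ 2 + 5), ?_⟩⟩
  · rw [h₁, mul_zero]
  · rw [h₂, sq]
  · rw [h₃, sq]

/-- Modulo `13` the induced curve becomes `y² = (x - 1)(x - 2)(x + 2)`, which is smooth and has exactly
`16` points over `ℤ/13ℤ`. -/
theorem family_hasTorsion {ι : K} (hι : ι ^ 2 = -1) (ht : HasResidue φ t 2)
    (ha : a = t * (t ^ 4 + 2 * t ^ 2 + 5) / (3 * t ^ 4 + 6 * t ^ 2 - 1)) (hb : b = -1 / a)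
    (hc : c = 16 * t * (t ^ 4 - 1) * (t ^ 2 - 1) /
        ((t ^ 4 + 2 * t ^ 2 + 5) * (3 * t ^ 4 + 6 * t ^ 2 - 1))) :
    HasTorsion (inducedCurve a b c) 4 4 := by
  obtain ⟨hn, hd, hra, hrb, hrc⟩ := family_residues ht ha hb hc
  have hdio := family_isDiophantineTriple ht ha hb hc
  have h2 : (2 : K) ≠ 0 := (HasResidue.ofNat φ 2).ne_zero (by decide)
  have ht0 := ht.ne_zero (by decide)
  have hn0 := hn.ne_zero (by decide)
  have hd0 := hd.ne_zero (by decide)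
  have := inducedCurve_isElliptic h2 hdio
  obtain ⟨h₁, h₂, h₃, h₄⟩ := family_identities rfl rfl ht0 hn0 hd0 ha hb hc
  have hk : t ^ 4 - 6 * t ^ 2 - 3 ≠ 0 :=
    (((ht.pow 4).sub ((HasResidue.ofNat φ 6).mul (ht.pow 2))).sub (.ofNat φ 3)).ne_zero (by decide)
  have hm : 5 * t ^ 4 + 2 * t ^ 2 + 1 ≠ 0 :=
    ((((HasResidue.ofNat φ 5).mul (ht.pow 4)).add ((HasResidue.ofNat φ 2).mul (ht.pow 2))).add
      (.one φ)).ne_zero (by decide)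
  have hl : 4 * (t ^ 4 - 1) * (t ^ 4 + 6 * t ^ 2 + 1) ≠ 0 :=
    (((HasResidue.ofNat φ 4).mul ((ht.pow 4).sub (.one φ))).mul (((ht.pow 4).add
      ((HasResidue.ofNat φ 6).mul (ht.pow 2))).add (.one φ))).ne_zero (by decide)
  refine hasTorsion_four_four_of_squares h2 hι
    (p := (t ^ 4 - 6 * t ^ 2 - 3) / (t ^ 4 + 2 * t ^ 2 + 5))
    (q := (5 * t ^ 4 + 2 * t ^ 2 + 1) / (3 * t ^ 4 + 6 * t ^ 2 - 1))
    (r := 4 * (t ^ 4 - 1) * (t ^ 4 + 6 * t ^ 2 + 1) /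
      ((t ^ 4 + 2 * t ^ 2 + 5) * (3 * t ^ 4 + 6 * t ^ 2 - 1)))
    ?_ ?_ ?_ (div_ne_zero hk hn0) (div_ne_zero hm hd0) (div_ne_zero hl (mul_ne_zero hn0 hd0)) ?_
  · linear_combination h₃ - h₁
  · linear_combination h₂ - h₁
  · exact h₄
  · intro _
    have hA₂ : HasResidue φ (inducedCurve a b c).a₂ _ :=
      ((hra.mul hrb).add (hrb.mul hrc)).add (hra.mul hrc)
    have hA₄ : HasResidue φ (inducedCurve a b c).a₄ _ :=
      ((((hra.pow 2).mul hrb).mul hrc).add ((hra.mul (hrb.pow 2)).mul hrc)).add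
        ((hra.mul hrb).mul (hrc.pow 2))
    have hA₆ : HasResidue φ (inducedCurve a b c).a₆ _ :=
      ((hra.pow 2).mul (hrb.pow 2)).mul (hrc.pow 2)
    obtain ⟨A₂, h₂, h₂'⟩ := hA₂
    obtain ⟨A₄, h₄, h₄'⟩ := hA₄
    obtain ⟨A₆, h₆, h₆'⟩ := hA₆
    have key := finite_torsion_and_card_le rfl rfl h₂ h₄ h₆ (by norm_num) h₂' h₄' h₆' (by decide)
    exact ⟨key.1, key.2.trans (by decide)⟩

/-- The three hypotheses are `b + c ≠ a`, `a + c ≠ b` and `a + b ≠ c` with denominators cleared. -/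
theorem family_infinite_order {ι : K} (hι : ι ^ 2 = -1) (ht : HasResidue φ t 2)
    (ha : a = t * (t ^ 4 + 2 * t ^ 2 + 5) / (3 * t ^ 4 + 6 * t ^ 2 - 1)) (hb : b = -1 / a)
    (hc : c = 16 * t * (t ^ 4 - 1) * (t ^ 2 - 1) /
        ((t ^ 4 + 2 * t ^ 2 + 5) * (3 * t ^ 4 + 6 * t ^ 2 - 1)))
    (h₁ : 16 * t ^ 2 * (t ^ 4 - 1) * (t ^ 2 - 1) ≠
      t ^ 2 * (t ^ 4 + 2 * t ^ 2 + 5) ^ 2 + (3 * t ^ 4 + 6 * t ^ 2 - 1) ^ 2)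
    (h₂ : 16 * t ^ 2 * (t ^ 4 - 1) * (t ^ 2 - 1) ≠
      -(t ^ 2 * (t ^ 4 + 2 * t ^ 2 + 5) ^ 2 + (3 * t ^ 4 + 6 * t ^ 2 - 1) ^ 2))
    (h₃ : 16 * t ^ 2 * (t ^ 4 - 1) * (t ^ 2 - 1) ≠
      t ^ 2 * (t ^ 4 + 2 * t ^ 2 + 5) ^ 2 - (3 * t ^ 4 + 6 * t ^ 2 - 1) ^ 2) :
    IsPointOfInfiniteOrder (inducedCurve a b c) 0 (a * b * c) := by
  obtain ⟨hn, hd, -⟩ := family_residues ht ha hb hc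
  have hdio := family_isDiophantineTriple ht ha hb hc
  have h2 : (2 : K) ≠ 0 := (HasResidue.ofNat φ 2).ne_zero (by decide)
  have ht0 := ht.ne_zero (by decide)
  have hn0 := hn.ne_zero (by decide)
  have hd0 := hd.ne_zero (by decide)
  have := inducedCurve_isElliptic h2 hdio
  obtain ⟨ea, eb, ec⟩ := family_linear ht0 hn0 hd0 ha hb hc
  refine isPointOfInfiniteOrder_zero_mul h2 hdio.a_ne_zero hdio.b_ne_zero hdio.c_ne_zero
    (family_hasTorsion hι ht ha hb hc) (fun h => h₁ ?_) (fun h => h₂ ?_) (fun h => h₃ ?_)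
  · linear_combination t * (t ^ 4 + 2 * t ^ 2 + 5) * (3 * t ^ 4 + 6 * t ^ 2 - 1) * h +
      ea - eb - ec
  · linear_combination t * (t ^ 4 + 2 * t ^ 2 + 5) * (3 * t ^ 4 + 6 * t ^ 2 - 1) * h +
      eb - ea - ec
  · linear_combination -t * (t ^ 4 + 2 * t ^ 2 + 5) * (3 * t ^ 4 + 6 * t ^ 2 - 1) * h +
      ea + eb - ec

end Member

/-- The integers `t = 2 + 13 k` give triples over `ℚ(i)` in which `a` is a rational number at
least `k`, hence infinitely many different ones. -/
theorem infinite_setOf_triples : {s : Set QI | ∃ a b c : QI, s = {a, b, c} ∧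
    IsDiophantineTriple a b c ∧ (inducedCurve a b c).IsElliptic ∧
    HasTorsion (inducedCurve a b c) 4 4}.Infinite := by
  obtain ⟨φ⟩ := exists_ringHom_padic
  obtain ⟨ι, hι⟩ := exists_sq_eq_neg_one_QI
  intro hfin
  have hU := hfin.biUnion (t := fun s => s) (by
    rintro s ⟨a, b, c, rfl, -⟩
    exact (Set.finite_singleton c).insert b |>.insert a)
  have hV := hU.preimage (f := ((↑) : ℚ → QI)) Rat.cast_injective.injOn
  obtain ⟨M, hM⟩ := hV.bddAbove
  obtain ⟨k, hk⟩ := exists_nat_gt M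
  obtain ⟨u, hu⟩ : ∃ u : ℚ, u = 2 + 13 * k := ⟨_, rfl⟩
  have hu0 : 0 < u := by rw [hu]; positivity
  have ht : HasResidue φ (u : QI) 2 := by
    refine ⟨2 + 13 * k, ?_, ?_⟩
    · rw [hu]
      push_cast
      rw [map_add, map_mul, map_ofNat, map_ofNat, map_natCast]
      rfl
    have h13 : (13 : ZMod 13) = 0 := by decide
    rw [map_add, map_mul, map_ofNat, map_ofNat, h13, zero_mul, add_zero]
  have hdio := family_isDiophantineTriple ht rfl rfl rfl
  have h2 : (2 : QI) ≠ 0 := two_ne_zero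
  have hle := hM (show u * (u ^ 4 + 2 * u ^ 2 + 5) / (3 * u ^ 4 + 6 * u ^ 2 - 1) ∈ _ from by
    rw [Set.mem_preimage, Set.mem_iUnion₂]
    refine ⟨_, ⟨_, _, _, rfl, hdio, inducedCurve_isElliptic h2 hdio,
      family_hasTorsion hι ht rfl rfl rfl⟩, Or.inl ?_⟩
    push_cast
    rfl)
  have hu2 : 2 ≤ u := by rw [hu]; linarith [(Nat.cast_nonneg k : (0 : ℚ) ≤ k)]
  have hden : 0 < 3 * u ^ 4 + 6 * u ^ 2 - 1 := by nlinarith [pow_pos hu0 4]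
  have hge : u / 3 ≤ u * (u ^ 4 + 2 * u ^ 2 + 5) / (3 * u ^ 4 + 6 * u ^ 2 - 1) := by
    rw [div_le_div_iff₀ (by norm_num) hden]
    nlinarith
  have : (k : ℚ) ≤ u / 3 := by rw [hu]; linarith [(Nat.cast_nonneg k : (0 : ℚ) ≤ k)]
  linarith

end Family

theorem theorem3 :
    {s : Set QI | ∃ a b c : QI, s = {a, b, c} ∧ IsDiophantineTriple a b c ∧
      (inducedCurve a b c).IsElliptic ∧ HasTorsion (inducedCurve a b c) 4 4}.Infinite ∧
    ∃ t a b c : RatFunc QI, t = RatFunc.X ∧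
      a = t * (t ^ 4 + 2 * t ^ 2 + 5) / (3 * t ^ 4 + 6 * t ^ 2 - 1) ∧
      b = -1 / a ∧
      c = 16 * t * (t ^ 4 - 1) * (t ^ 2 - 1) /
        ((t ^ 4 + 2 * t ^ 2 + 5) * (3 * t ^ 4 + 6 * t ^ 2 - 1)) ∧
      IsDiophantineTriple a b c ∧
      (inducedCurve a b c).IsElliptic ∧
      HasTorsion (inducedCurve a b c) 4 4 ∧
      HasPositiveRank (inducedCurve a b c) ∧
      IsPointOfInfiniteOrder (inducedCurve a b c) 0 (a * b * c) := by
  refine ⟨infinite_setOf_triples, RatFunc.X, _, _, _, rfl, rfl, rfl, rfl, ?_⟩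
  obtain ⟨φ⟩ := exists_ringHom_padic
  obtain ⟨ι, hι⟩ := exists_sq_eq_neg_one_QI
  obtain ⟨ψ, T, hψ, hT⟩ := exists_ringHom_ratFunc_padic φ
  have ht : HasResidue ψ RatFunc.X 2 := ⟨T, hψ, hT⟩
  have hι' : (algebraMap QI (RatFunc QI) ι) ^ 2 = -1 := by rw [← map_pow, hι, map_neg, map_one]
  have h2 : (2 : RatFunc QI) ≠ 0 := (HasResidue.ofNat ψ 2).ne_zero (by decide)
  have hdio := family_isDiophantineTriple ht rfl rfl rfl
  -- polynomial identities in the variable are refuted by evaluation at `0`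
  have heval : ∀ F G : Polynomial QI, F.eval 0 ≠ G.eval 0 →
      algebraMap (Polynomial QI) (RatFunc QI) F ≠ algebraMap (Polynomial QI) (RatFunc QI) G :=
    fun F G h h' => h (congrArg (Polynomial.eval 0) (RatFunc.algebraMap_injective QI h'))
  have hord := family_infinite_order hι' ht rfl rfl rfl
    (by
      have := heval (16 * .X ^ 2 * (.X ^ 4 - 1) * (.X ^ 2 - 1))
        (.X ^ 2 * (.X ^ 4 + 2 * .X ^ 2 + 5) ^ 2 + (3 * .X ^ 4 + 6 * .X ^ 2 - 1) ^ 2) (by simp)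
      simpa only [map_add, map_sub, map_mul, map_pow, map_ofNat, map_one, RatFunc.algebraMap_X]
        using this)
    (by
      have := heval (16 * .X ^ 2 * (.X ^ 4 - 1) * (.X ^ 2 - 1))
        (-(.X ^ 2 * (.X ^ 4 + 2 * .X ^ 2 + 5) ^ 2 + (3 * .X ^ 4 + 6 * .X ^ 2 - 1) ^ 2)) (by simp)
      simpa only [map_add, map_sub, map_mul, map_pow, map_ofNat, map_one, map_neg,
        RatFunc.algebraMap_X] using this)
    (by
      have := heval (16 * .X ^ 2 * (.X ^ 4 - 1) * (.X ^ 2 - 1))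
        (.X ^ 2 * (.X ^ 4 + 2 * .X ^ 2 + 5) ^ 2 - (3 * .X ^ 4 + 6 * .X ^ 2 - 1) ^ 2) (by simp)
      simpa only [map_add, map_sub, map_mul, map_pow, map_ofNat, map_one, RatFunc.algebraMap_X]
        using this)
  exact ⟨hdio, inducedCurve_isElliptic h2 hdio, family_hasTorsion hι' ht rfl rfl rfl,
    hasPositiveRank_of_infinite_order hord, hord⟩
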